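/- Conventions. A represented space is a set together with a partial surjection from $\mathbb{N}^{\mathbb{N}}$ onto it; a preimage of a point is called a name of the point. A function between represented spaces is computable (resp. belongs to $\mathcal{C}(\mathbf{X},\mathbf{Y})$) if some computable (resp. continuous) partial function on $\mathbb{N}^{\mathbb{N}}$ maps every name of every point $x$ to a name of $f(x)$; a name of $f\in\mathcal{C}(\mathbf{X},\mathbf{Y})$ is a code of such a continuous realizer. Subsets carry the restricted representation, and $\mathbb{N}$ and products the usual ones. $\mathcal{O}(\mathbf{X})$ is the space of open sets, named through their characteristic functions in $\mathcal{C}(\mathbf{X},\mathbb{S})$, where $\mathbb{S}$ is Sierpiński space, and $\mathcal{A}(\mathbf{X})$ is the space of closed sets, named through their complements. A computable metric space is a metric space with a fixed dense sequence $(\alpha_i)_{i\in\mathbb{N}}$ such that the real numbers $d(\alpha_i,\alpha_j)$ are computable uniformly in $i,j$; it is represented by naming points through sequences of indices of members of the dense sequence that converge to the point at rate $2^{-k}$. For a computable metric space $\mathbf{X}$, the space $\Delta^0_2(\mathbf{X})$ consists of the sets $D=\bigcup_{i}A_i=\bigcap_{i}U_i$ with $(A_i,U_i)_{i\in\mathbb{N}}\in\mathcal{C}(\mathbb{N},\mathcal{A}(\mathbf{X})\times\mathcal{O}(\mathbf{X}))$,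 and the names of such sequences are the names of $D$. For computable metric spaces $\mathbf{X},\mathbf{Y}$, the space $\Delta^0_2(\mathbf{X},\mathbf{Y})$ consists of the functions $f:X\to Y$ whose preimage map $f^{-1}$ is an element of $\mathcal{C}(\mathcal{O}(\mathbf{Y}),\Delta^0_2(\mathbf{X}))$, and a name of $f$ is a name of $f^{-1}$ in that space. The space $\mathcal{C}^{\mathcal{A}\text{-}pw}(\mathbf{X},\mathbf{Y})$ of closed-piecewise continuous functions consists of the functions $f:X\to Y$ for which there is a sequence $(A_i,f_i)_{i\in\mathbb{N}}$ of pairs with $A_i\in\mathcal{A}(\mathbf{X})$ and $f_i\in\mathcal{C}(\mathbf{A}_i,\mathbf{Y})$, such that $X=\bigcup_i A_i$ and $f_i=f|_{A_i}$ for all $i$; a name of $f$ is a name of such a sequence (as a continuous function of $i\in\mathbb{N}$). Theorem (computable Jayne–Rogers theorem). For all computable metric spaces $\mathbf{X},\mathbf{Y}$, the maps $$\mathrm{id}:\Delta^0_2(\mathbf{X},\mathbf{Y})\to\mathcal{C}^{\mathcal{A}\text{-}pw}(\mathbf{X},\mathbf{Y})\quad\text{and}\quad \mathrm{id}:\mathcal{C}^{\mathcal{A}\text{-}pw}(\mathbf{X},\mathbf{Y})\to\Delta^0_2(\mathbf{X},\mathbf{Y})$$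 are well-defined (every element of the first space is an element of the second) and computable. -/

import Mathlib

namespace TTE

/-! ### Type-2 computability on Baire space -/

/-- The prefix of length `k` of the infinite sequence `q`. -/
def pref (q : ℕ → ℕ) (k : ℕ) : List ℕ := (List.range k).map q

/-- `Applies p q r`: the partial continuous function on Baire space coded by `p` is defined at `q`
and has value `r` there. The code `p` is read as a table: to obtain the `n`-th output symbol one
inspects longer and longer prefixes of the input `q`; a table entry `0` means that more input is
needed, an entry `m + 1` means that the output symbol is `m` (Kleene application). -/
def Applies (p q r : ℕ → ℕ) : Prop :=
  ∀ n : ℕ, ∃ k : ℕ, (∀ j < k, p (Encodable.encode (n, pref q j)) = 0) ∧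
    p (Encodable.encode (n, pref q k)) = r n + 1

theorem Applies.unique {p q r r' : ℕ → ℕ} (h : Applies p q r) (h' : Applies p q r') : r = r' := by
  funext n
  obtain ⟨k, hk, hk'⟩ := h n
  obtain ⟨l, hl, hl'⟩ := h' n
  rcases lt_trichotomy k l with hlt | heq | hlt
  · have := hl k hlt
    omega
  · subst heq
    omega
  · have := hk l hlt
    omega

/-- The first component of a pair of sequences coded as one sequence. -/
def evenPart (r : ℕ → ℕ) : ℕ → ℕ := fun n => r (2 * n)

/-- The second component of a pair of sequences coded as one sequence. -/
def oddPart (r : ℕ → ℕ) : ℕ → ℕ := fun n => r (2 * n + 1)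

theorem exists_pair (p q : ℕ → ℕ) : ∃ r, evenPart r = p ∧ oddPart r = q := by
  refine ⟨fun n => if n % 2 = 0 then p (n / 2) else q (n / 2), ?_, ?_⟩
  · funext n
    simp [evenPart]
  · funext n
    have h1 : (2 * n + 1) % 2 = 1 := by omega
    have h2 : (2 * n + 1) / 2 = n := by omega
    simp [oddPart, h1, h2]

/-! ### Represented spaces -/

/-- A represented space: a partial surjection from Baire space onto `X`, given by its graph
`IsName p x` ("the sequence `p` is a name of `x`"). -/
class RepSpace (X : Type*) where
  IsName : (ℕ → ℕ) → X → Prop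
  unique : ∀ {p : ℕ → ℕ} {x y : X}, IsName p x → IsName p y → x = y
  exists_name : ∀ x : X, ∃ p : ℕ → ℕ, IsName p x

open RepSpace

/-- `Realizes p f`: the partial function on Baire space coded by `p` maps every name of every
point `x` to some name of `f x`. -/
def Realizes {X Y : Type*} [RepSpace X] [RepSpace Y] (p : ℕ → ℕ) (f : X → Y) : Prop :=
  ∀ (x : X) (q : ℕ → ℕ), IsName q x → ∃ r : ℕ → ℕ, Applies p q r ∧ IsName r (f x)

/-- A function between represented spaces is computable if it has a computable realizer. -/
def IsComputable {X Y : Type*} [RepSpace X] [RepSpace Y] (f : X → Y) : Prop :=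
  ∃ p : ℕ → ℕ, Computable p ∧ Realizes p f

/-- The space `𝒞(X, Y)` of functions with a continuous realizer. -/
@[ext]
structure ContFun (X Y : Type*) [RepSpace X] [RepSpace Y] where
  toFun : X → Y
  realizable : ∃ p : ℕ → ℕ, Realizes p toFun

/-- A name of `f ∈ 𝒞(X, Y)` is a code of a continuous realizer of `f`. -/
instance ContFun.repSpace {X Y : Type*} [RepSpace X] [RepSpace Y] : RepSpace (ContFun X Y) where
  IsName p f := Realizes p f.toFun
  unique := by
    intro p f g hf hg
    ext x
    obtain ⟨q, hq⟩ := exists_name x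
    obtain ⟨r, hr, hr'⟩ := hf x q hq
    obtain ⟨s, hs, hs'⟩ := hg x q hq
    obtain rfl := hr.unique hs
    exact RepSpace.unique hr' hs'
  exists_name f := f.realizable

/-- The natural numbers: `p` is a name of `p 0`. -/
instance natRepSpace : RepSpace ℕ where
  IsName p n := p 0 = n
  unique := by
    intro p m n hm hn
    exact hm.symm.trans hn
  exists_name n := ⟨fun _ => n, rfl⟩

/-- The product of two represented spaces. -/
instance prodRepSpace {X Y : Type*} [RepSpace X] [RepSpace Y] : RepSpace (X × Y) where
  IsName r z := IsName (evenPart r) z.1 ∧ IsName (oddPart r) z.2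
  unique := by
    intro r z w hz hw
    exact Prod.ext (RepSpace.unique hz.1 hw.1) (RepSpace.unique hz.2 hw.2)
  exists_name z := by
    obtain ⟨p, hp⟩ := exists_name z.1
    obtain ⟨q, hq⟩ := exists_name z.2
    obtain ⟨r, rfl, rfl⟩ := exists_pair p q
    exact ⟨r, hp, hq⟩

/-- The dependent sum of represented spaces: a name is a pair of a name of the index and a name of
the second component. -/
instance sigmaRepSpace {I : Type*} {F : I → Type*} [RepSpace I] [∀ i, RepSpace (F i)] :
    RepSpace (Σ i, F i) where
  IsName r z := IsName (evenPart r) z.1 ∧ IsName (oddPart r) z.2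
  unique := by
    rintro r ⟨i, a⟩ ⟨j, b⟩ hz hw
    obtain rfl : i = j := RepSpace.unique hz.1 hw.1
    obtain rfl : a = b := RepSpace.unique hz.2 hw.2
    rfl
  exists_name z := by
    obtain ⟨p, hp⟩ := exists_name z.1
    obtain ⟨q, hq⟩ := exists_name z.2
    obtain ⟨r, rfl, rfl⟩ := exists_pair p q
    exact ⟨r, hp, hq⟩

/-- The subspace of a represented space given by a subset. -/
instance subspaceRepSpace {X : Type*} [RepSpace X] (A : Set X) : RepSpace A where
  IsName p x := IsName p (x : X)
  unique := by
    intro p x y hx hy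
    exact Subtype.ext (RepSpace.unique hx hy)
  exists_name x := exists_name (x : X)

/-- Sierpinski space, the two truth values. -/
@[ext]
structure Sierpinski where
  holds : Prop

/-- The sequence `p` is a name of "true" if it has a nonzero entry, and of "false" otherwise. -/
instance Sierpinski.repSpace : RepSpace Sierpinski where
  IsName p s := (∃ n, p n ≠ 0) ↔ s.holds
  unique := by
    intro p s t hs ht
    ext
    exact hs.symm.trans ht
  exists_name s := by
    classical
    exact ⟨fun _ => if s.holds then 1 else 0, by simp⟩

/-- The characteristic function of a set, with values in Sierpinski space. -/
def charFun {X : Type*} (U : Set X) : X → Sierpinski := fun x => ⟨x ∈ U⟩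

/-- The space `𝒪(X)` of open subsets: those with a continuously realizable characteristic function
into Sierpinski space. -/
@[ext]
structure OpenSet (X : Type*) [RepSpace X] where
  carrier : Set X
  realizable : ∃ p : ℕ → ℕ, Realizes p (charFun carrier)

theorem charFun_unique {X : Type*} [RepSpace X] {p : ℕ → ℕ} {U V : Set X}
    (hU : Realizes p (charFun U)) (hV : Realizes p (charFun V)) : U = V := by
  have h : (⟨charFun U, p, hU⟩ : ContFun X Sierpinski) = ⟨charFun V, p, hV⟩ :=
    RepSpace.unique (p := p) hU hV
  ext x
  have h2 := congrFun (congrArg ContFun.toFun h) x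
  exact iff_of_eq (congrArg Sierpinski.holds h2)

/-- A name of an open set is a name of its characteristic function in `𝒞(X, Sierpinski)`. -/
instance OpenSet.repSpace {X : Type*} [RepSpace X] : RepSpace (OpenSet X) where
  IsName p U := Realizes p (charFun U.carrier)
  unique := by
    intro p U V hU hV
    exact OpenSet.ext (charFun_unique hU hV)
  exists_name U := U.realizable

/-- The space `𝒜(X)` of closed subsets: the complements of the elements of `𝒪(X)`. -/
@[ext]
structure ClosedSet (X : Type*) [RepSpace X] where
  carrier : Set X
  realizable : ∃ p : ℕ → ℕ, Realizes p (charFun carrierᶜ)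

/-- A name of a closed set is a name of its complement as an open set. -/
instance ClosedSet.repSpace {X : Type*} [RepSpace X] : RepSpace (ClosedSet X) where
  IsName p A := Realizes p (charFun A.carrierᶜ)
  unique := by
    intro p A B hA hB
    exact ClosedSet.ext (compl_injective (charFun_unique hA hB))
  exists_name A := A.realizable

/-! ### Computable metric spaces -/

/-- A computable metric space: a metric space with a fixed dense sequence such that the distances
between members of the sequence are real numbers computable uniformly in the indices. -/
class ComputableMetricSpace (X : Type*) [MetricSpace X] where
  denseSeq : ℕ → X
  denseRange : DenseRange denseSeq
  computable_dist : ∃ g : ℕ × ℕ × ℕ → ℕ, Computable g ∧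
    ∀ i j k : ℕ, |dist (denseSeq i) (denseSeq j) - (g (i, j, k) : ℝ) / 2 ^ k| ≤ 1 / 2 ^ k

open ComputableMetricSpace

/-- The Cauchy representation: `p` is a name of `x` if the `k`-th entry of `p` is the index of a
member of the dense sequence at distance less than `2 ^ (-k)` from `x`. -/
instance cauchyRepSpace {X : Type*} [MetricSpace X] [ComputableMetricSpace X] : RepSpace X where
  IsName p x := ∀ k : ℕ, dist (denseSeq (p k)) x < 1 / 2 ^ k
  unique := by
    intro p x y hx hy
    refine eq_of_forall_dist_le fun ε hε => ?_
    obtain ⟨k, hk⟩ := exists_pow_lt_of_lt_one (half_pos hε) (by norm_num : (1 / 2 : ℝ) < 1)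
    rw [one_div_pow] at hk
    have h := dist_triangle_left x y (denseSeq (p k))
    have h1 := hx k
    have h2 := hy k
    linarith
  exists_name x := by
    have h : ∀ k : ℕ, ∃ i : ℕ, dist (denseSeq i : X) x < 1 / 2 ^ k := by
      intro k
      obtain ⟨i, hi⟩ := (denseRange (X := X)).exists_dist_lt x
        (by positivity : (0 : ℝ) < 1 / 2 ^ k)
      exact ⟨i, by rwa [dist_comm]⟩
    exact ⟨fun k => (h k).choose, fun k => (h k).choose_spec⟩

/-- In a computable metric space the complements of points belong to `𝒪(Y)`. -/
theorem realizable_compl_singleton {Y : Type*} [MetricSpace Y] [ComputableMetricSpace Y] (y : Y) :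
    ∃ p : ℕ → ℕ, Realizes p (charFun ({y}ᶜ : Set Y)) := by
  classical
  let t : ℕ → ℕ → ℕ := fun n i => if 1 / 2 ^ n ≤ dist (denseSeq i) y then 1 else 0
  let P : ℕ × List ℕ → ℕ := fun a => if a.1 < a.2.length then t a.1 (a.2.getD a.1 0) + 1 else 0
  refine ⟨fun c => ((Encodable.decode c : Option (ℕ × List ℕ)).map P).getD 0, ?_⟩
  intro x q hq
  refine ⟨fun n => t n (q n), fun n => ⟨n + 1, ?_, ?_⟩, ?_⟩
  · intro j hj
    have : ¬ n < j := by omega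
    simp [P, pref, this]
  · simp [P, pref]
  · change (∃ n, t n (q n) ≠ 0) ↔ x ∈ ({y}ᶜ : Set Y)
    constructor
    · rintro ⟨n, hn⟩ hxy
      obtain rfl : x = y := hxy
      exact hn (if_neg (not_le.2 (hq n)))
    · intro hxy
      have hpos : 0 < dist x y := dist_pos.2 hxy
      obtain ⟨n, hn⟩ := exists_pow_lt_of_lt_one (half_pos hpos) (by norm_num : (1 / 2 : ℝ) < 1)
      rw [one_div_pow] at hn
      have h1 := hq n
      have h2 := dist_triangle_left x y (denseSeq (q n))
      have h3 : 1 / 2 ^ n ≤ dist (denseSeq (q n)) y := by linarith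
      exact ⟨n, by simp only [t, if_pos h3]; exact one_ne_zero⟩

/-! ### `Δ⁰₂` sets, `Δ⁰₂`-measurable functions, piecewise continuous functions -/

/-- The sequence `s` of pairs of a closed set `A i` and an open set `U i` determines the set `D`:
`D` is the union of all `A i` and also the intersection of all `U i`. -/
def Delta2Presents {X : Type*} [RepSpace X] (s : ContFun ℕ (ClosedSet X × OpenSet X))
    (D : Set X) : Prop :=
  D = ⋃ i, (s.toFun i).1.carrier ∧ D = ⋂ i, (s.toFun i).2.carrier

/-- The space `Δ⁰₂(X)` of `Δ⁰₂` subsets. -/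
@[ext]
structure Delta2Set (X : Type*) [RepSpace X] where
  carrier : Set X
  presented : ∃ s : ContFun ℕ (ClosedSet X × OpenSet X), Delta2Presents s carrier

instance Delta2Set.repSpace {X : Type*} [RepSpace X] : RepSpace (Delta2Set X) where
  IsName p D := ∃ s : ContFun ℕ (ClosedSet X × OpenSet X), IsName p s ∧ Delta2Presents s D.carrier
  unique := by
    rintro p D E ⟨s, hs, hsD⟩ ⟨t, ht, htE⟩
    obtain rfl := RepSpace.unique hs ht
    exact Delta2Set.ext (hsD.1.trans htE.1.symm)
  exists_name D := by
    obtain ⟨s, hs⟩ := D.presented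
    obtain ⟨p, hp⟩ := exists_name s
    exact ⟨p, s, hp, hs⟩

/-- The element `g` of `𝒞(𝒪(Y), Δ⁰₂(X))` is the preimage map `f⁻¹`. -/
def IsPreimageMap {X Y : Type*} [RepSpace X] [RepSpace Y]
    (g : ContFun (OpenSet Y) (Delta2Set X)) (f : X → Y) : Prop :=
  ∀ U : OpenSet Y, (g.toFun U).carrier = f ⁻¹' U.carrier

/-- The function `f` belongs to the space `Δ⁰₂(X, Y)`: its preimage map is an element of
`𝒞(𝒪(Y), Δ⁰₂(X))`. -/
def IsDelta2Measurable {X Y : Type*} [RepSpace X] [RepSpace Y] (f : X → Y) : Prop :=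
  ∃ g : ContFun (OpenSet Y) (Delta2Set X), IsPreimageMap g f

/-- The space `Δ⁰₂(X, Y)` of (continuously) `Δ⁰₂`-measurable functions. -/
@[ext]
structure Delta2Fun (X Y : Type*) [RepSpace X] [RepSpace Y] where
  toFun : X → Y
  measurable : IsDelta2Measurable toFun

/-- A name of `f ∈ Δ⁰₂(X, Y)` is a name of `f⁻¹` in `𝒞(𝒪(Y), Δ⁰₂(X))`. -/
instance Delta2Fun.repSpace {X Y : Type*} [RepSpace X] [MetricSpace Y] [ComputableMetricSpace Y] :
    RepSpace (Delta2Fun X Y) where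
  IsName p f := ∃ g : ContFun (OpenSet Y) (Delta2Set X), IsName p g ∧ IsPreimageMap g f.toFun
  unique := by
    rintro p f f' ⟨g, hg, hgf⟩ ⟨g', hg', hgf'⟩
    obtain rfl := RepSpace.unique hg hg'
    ext x
    by_contra hne
    let U : OpenSet Y := ⟨{f'.toFun x}ᶜ, realizable_compl_singleton _⟩
    have h : f.toFun ⁻¹' U.carrier = f'.toFun ⁻¹' U.carrier := (hgf U).symm.trans (hgf' U)
    have h1 : x ∈ f.toFun ⁻¹' U.carrier := hne
    rw [h] at h1
    exact h1 rfl
  exists_name f := by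
    obtain ⟨g, hg⟩ := f.measurable
    obtain ⟨p, hp⟩ := exists_name g
    exact ⟨p, g, hp, hg⟩

/-- The sequence `s` of closed sets `A i` and continuous functions `f i` on the subspaces `A i` is
a decomposition of `f`: the sets `A i` cover `X`, and `f i` is the restriction of `f` to `A i`. -/
def IsDecomposition {X Y : Type*} [RepSpace X] [RepSpace Y]
    (s : ContFun ℕ (Σ A : ClosedSet X, ContFun A.carrier Y)) (f : X → Y) : Prop :=
  (⋃ i, (s.toFun i).1.carrier) = Set.univ ∧
    ∀ (i : ℕ) (x : (s.toFun i).1.carrier), (s.toFun i).2.toFun x = f x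

/-- The function `f` is closed-piecewise continuous. -/
def IsPiecewiseContinuous {X Y : Type*} [RepSpace X] [RepSpace Y] (f : X → Y) : Prop :=
  ∃ s : ContFun ℕ (Σ A : ClosedSet X, ContFun A.carrier Y), IsDecomposition s f

/-- The space of closed-piecewise continuous functions. -/
@[ext]
structure PiecewiseFun (X Y : Type*) [RepSpace X] [RepSpace Y] where
  toFun : X → Y
  piecewise : IsPiecewiseContinuous toFun

/-- A name of a closed-piecewise continuous function is a name of a decomposition of it. -/
instance PiecewiseFun.repSpace {X Y : Type*} [RepSpace X] [RepSpace Y] :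
    RepSpace (PiecewiseFun X Y) where
  IsName p f := ∃ s : ContFun ℕ (Σ A : ClosedSet X, ContFun A.carrier Y),
    IsName p s ∧ IsDecomposition s f.toFun
  unique := by
    rintro p f f' ⟨s, hs, hsf⟩ ⟨s', hs', hsf'⟩
    obtain rfl := RepSpace.unique hs hs'
    ext x
    have hx : x ∈ ⋃ i, (s.toFun i).1.carrier := by
      rw [hsf.1]
      exact Set.mem_univ x
    obtain ⟨i, hi⟩ := Set.mem_iUnion.1 hx
    exact (hsf.2 i ⟨x, hi⟩).symm.trans (hsf'.2 i ⟨x, hi⟩)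
  exists_name f := by
    obtain ⟨s, hs⟩ := f.piecewise
    obtain ⟨p, hp⟩ := exists_name s
    exact ⟨p, s, hp, hs⟩

end TTE

/-!
A function `f` is treated through finite prefixes of names. A realizer is given by a table, and
`applyList P Q` is the part of the output that prefixes `P` of the table and `Q` of the input
determine; it is a primitive recursive function of two lists, it only produces correct symbols
(`applyList_sound`), and it produces arbitrarily many of them (`applyList_complete`). All tables
below are assembled from tests on such prefixes, so that they are primitive recursive; comparisons
of distances, which are only semidecidable, enter through `Near` and `Far`.

**From `Δ⁰₂`-measurable to piecewise continuous.** A sequence `e` of codes of balls enumerates an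
open set `ballsUnion Y e`, and a name of `f⁻¹` provides open sets `W e i` whose intersection over
`i` is the preimage of this set. That `x` belongs to `W e i` is verified by a prefix of `e`. For a
finite sequence `w` of balls and an index `i`, read the balls `V` with `x ∈ W (w V V V ...) i` as a
description of the value `f x`. Every ball around `f x` is in the description. The piece with index
`(w, i)` is the set of those `x` for which no two balls in the description are apart: this condition
is closed, and on the piece every ball in the description contains `f x` up to its boundary
(`dist_le_of_mem_piece`), so that `f x` is computed by searching for small balls in the description.
The pieces cover the space by a Baire category argument on sequences of balls that avoid `f x`
(`exists_mem_piece`): if `x` were in no piece, then each finite sequence of balls avoiding `f x`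
could be extended to one that avoids `f x` and verifies `x ∈ W e i`. Doing this for all `i` in turn
gives `e` with `x ∈ ⋂ i, W e i` although `f x ∉ ballsUnion Y e`.

**From piecewise continuous to `Δ⁰₂`-measurable.** Let the closed sets `A i` cover the space, with
`f` continuous on each of them. Then `f⁻¹ U` is the intersection of the open sets
`{x | x ∈ A i → f x ∈ U}`. An open set `U` is an effective union of closed sets: each finite
computation that accepts the beginning `l` of a name shows that the open set of all points with a
name beginning with `l` is part of `U`, and this open set is the union of the closed sets
`shrink Y l m`. Hence `f⁻¹ U` is the union of the closed sets
`{x | x ∈ A i ∧ f x ∈ shrink Y l m}`.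
-/

namespace TTE

open RepSpace ComputableMetricSpace Encodable

/-! ### Prefixes and finite application -/

/-- The list `L` is a prefix of the sequence `p`. -/
def IsPref (L : List ℕ) (p : ℕ → ℕ) : Prop := L = pref p L.length

theorem length_pref (p : ℕ → ℕ) (k : ℕ) : (pref p k).length = k := by simp [pref]

theorem isPref_pref (p : ℕ → ℕ) (k : ℕ) : IsPref (pref p k) p := by
  simp [IsPref, length_pref]

theorem IsPref.getElem? {L : List ℕ} {p : ℕ → ℕ} (h : IsPref L p) {a : ℕ} (ha : a < L.length) :
    L[a]? = some (p a) := by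
  rw [h, pref]
  simp [ha]

theorem IsPref.getD {L : List ℕ} {p : ℕ → ℕ} (h : IsPref L p) {a : ℕ} (ha : a < L.length) (d : ℕ) :
    L.getD a d = p a := by
  rw [List.getD_eq_getElem?_getD, h.getElem? ha, Option.getD_some]

theorem IsPref.take {L : List ℕ} {p : ℕ → ℕ} (h : IsPref L p) {j : ℕ} (hj : j ≤ L.length) :
    L.take j = pref p j := by
  rw [h, pref, pref, ← List.map_take, List.take_range, min_eq_left hj]

theorem isPref_of_getElem {L : List ℕ} {p : ℕ → ℕ} (h : ∀ a (ha : a < L.length), L[a] = p a) :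
    IsPref L p := by
  refine List.ext_getElem (by simp [length_pref]) fun a ha _ => ?_
  rw [h a ha]
  simp [pref]

theorem isPref_replicate (k i : ℕ) : IsPref (List.replicate k i) fun _ => i :=
  isPref_of_getElem fun a ha => by simp

theorem findIdx_range (p : ℕ → Bool) (N : ℕ) :
    (List.range N).findIdx p ≤ N ∧ (∀ i < (List.range N).findIdx p, p i = false) ∧
      ((List.range N).findIdx p < N → p ((List.range N).findIdx p) = true) := by
  have hle : (List.range N).findIdx p ≤ N := by
    simpa using List.findIdx_le_length (xs := List.range N) (p := p)
  refine ⟨hle, fun i hi => ?_, fun h => ?_⟩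
  · have := List.not_of_lt_findIdx hi
    simpa using this
  · have h' : (List.range N).findIdx p < (List.range N).length := by simpa using h
    have := List.findIdx_getElem (w := h')
    simpa using this

/-- The result of the search for the `n`-th output symbol of the function coded by a sequence
extending `P`, on an input extending `Q`: `m + 1` if `P` and `Q` are long enough to determine that
this symbol is `m`, and `0` if they are not. -/
def applyVal (P Q : List ℕ) (n : ℕ) : ℕ :=
  (P[encode (n, Q.take ((List.range (Q.length + 1)).findIdx
    fun j => decide (P[encode (n, Q.take j)]? ≠ some 0)))]?).getD 0

/-- The part of the output of the function coded by a sequence extending `P`, on an input extending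
`Q`, that is determined by `P` and `Q`. -/
def applyList (P Q : List ℕ) : List ℕ :=
  (List.range ((List.range Q.length).findIdx fun n => decide (applyVal P Q n = 0))).map
    fun n => applyVal P Q n - 1

theorem applyVal_sound {p q r : ℕ → ℕ} (h : Applies p q r) {P Q : List ℕ} (hP : IsPref P p)
    (hQ : IsPref Q q) {n : ℕ} (hn : applyVal P Q n ≠ 0) : applyVal P Q n = r n + 1 := by
  obtain ⟨hle, hlt, -⟩ := findIdx_range
    (fun j => decide (P[encode (n, Q.take j)]? ≠ some 0)) (Q.length + 1)
  unfold applyVal at hn ⊢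
  set j₀ := (List.range (Q.length + 1)).findIdx
    fun j => decide (P[encode (n, Q.take j)]? ≠ some 0)
  have hzero : ∀ i < j₀, P[encode (n, Q.take i)]? = some 0 := fun i hi =>
    not_not.1 (of_decide_eq_false (hlt i hi))
  have hj : j₀ ≤ Q.length := by
    by_contra hcon
    have h1 := hzero Q.length (by omega)
    rw [List.take_length] at h1
    rw [List.take_of_length_le (by omega), h1] at hn
    exact hn rfl
  have hval : ∀ {a v}, P[a]? = some v → p a = v := fun {a v} ha => by
    obtain ⟨hl, -⟩ := List.getElem?_eq_some_iff.1 ha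
    rw [hP.getElem? hl] at ha
    exact Option.some.inj ha
  cases hv : P[encode (n, Q.take j₀)]? with
  | none =>
    rw [hv] at hn
    exact absurd rfl hn
  | some v =>
    rw [hv, Option.getD_some] at hn
    rw [Option.getD_some]
    have hp := hval hv
    rw [hQ.take hj] at hp
    have hp0 : ∀ i < j₀, p (encode (n, pref q i)) = 0 := fun i hi => by
      rw [← hQ.take (by omega)]
      exact hval (hzero i hi)
    obtain ⟨k, hk, hk'⟩ := h n
    rcases lt_trichotomy k j₀ with hlt | heq | hlt
    · have := hp0 k hlt
      omega
    · subst heq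
      omega
    · have := hk j₀ hlt
      omega

theorem applyVal_complete {p q r : ℕ → ℕ} (h : Applies p q r) (n : ℕ) :
    ∃ K, ∀ P Q, IsPref P p → IsPref Q q → K ≤ P.length → K ≤ Q.length →
      applyVal P Q n = r n + 1 := by
  obtain ⟨k, hk, hk'⟩ := h n
  refine ⟨max k ((Finset.range (k + 1)).sup fun j => encode (n, pref q j) + 1),
    fun P Q hP hQ hKP hKQ => applyVal_sound h hP hQ ?_⟩
  have hkQ : k ≤ Q.length := (le_max_left _ _).trans hKQ
  have hin : ∀ j ≤ k, P[encode (n, Q.take j)]? = some (p (encode (n, pref q j))) := by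
    intro j hj
    rw [hQ.take (hj.trans hkQ)]
    apply hP.getElem?
    have := Finset.le_sup (f := fun j => encode (n, pref q j) + 1)
      (Finset.mem_range.2 (Nat.lt_add_one_of_le hj))
    have h2 := (le_max_right _ _).trans hKP
    omega
  obtain ⟨hle, hlt, hfind⟩ := findIdx_range
    (fun j => decide (P[encode (n, Q.take j)]? ≠ some 0)) (Q.length + 1)
  unfold applyVal
  set j₀ := (List.range (Q.length + 1)).findIdx
    fun j => decide (P[encode (n, Q.take j)]? ≠ some 0)
  have hj : j₀ ≤ k := by
    by_contra hcon
    have h1 := hlt k (by omega)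
    rw [hin k le_rfl, hk'] at h1
    simp at h1
  have h1 := hfind (by omega)
  rw [hin j₀ hj] at h1 ⊢
  simpa using h1

theorem length_applyList (P Q : List ℕ) : (applyList P Q).length =
    (List.range Q.length).findIdx fun n => decide (applyVal P Q n = 0) := by
  simp [applyList]

theorem applyList_sound {p q r : ℕ → ℕ} (h : Applies p q r) {P Q : List ℕ} (hP : IsPref P p)
    (hQ : IsPref Q q) : IsPref (applyList P Q) r := by
  refine isPref_of_getElem fun a ha => ?_
  have h1 := (findIdx_range (fun n => decide (applyVal P Q n = 0)) Q.length).2.1 a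
    (by rwa [← length_applyList])
  have h2 := applyVal_sound h hP hQ (n := a) (by simpa using h1)
  simp [applyList, h2]

theorem applyList_complete {p q r : ℕ → ℕ} (h : Applies p q r) (N : ℕ) :
    ∃ K, ∀ P Q, IsPref P p → IsPref Q q → K ≤ P.length → K ≤ Q.length →
      N ≤ (applyList P Q).length := by
  choose K hK using applyVal_complete h
  refine ⟨max N ((Finset.range N).sup K), fun P Q hP hQ hKP hKQ => ?_⟩
  have hfind := (findIdx_range (fun n => decide (applyVal P Q n = 0)) Q.length).2.2
  rw [← length_applyList] at hfind
  by_contra! hcon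
  have h1 := hfind (hcon.trans_le ((le_max_left _ _).trans hKQ))
  have h2 : K (applyList P Q).length ≤ (Finset.range N).sup K :=
    Finset.le_sup (Finset.mem_range.2 hcon)
  have h3 := h2.trans (le_max_right N _)
  rw [hK _ P Q hP hQ (h3.trans hKP) (h3.trans hKQ)] at h1
  simp at h1

/-- The first components of a list read as a prefix of a pair of sequences. -/
def evenList (L : List ℕ) : List ℕ :=
  (List.range ((L.length + 1) / 2)).map fun n => L.getD (2 * n) 0

/-- The second components of a list read as a prefix of a pair of sequences. -/
def oddList (L : List ℕ) : List ℕ :=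
  (List.range (L.length / 2)).map fun n => L.getD (2 * n + 1) 0

theorem length_evenList (L : List ℕ) : (evenList L).length = (L.length + 1) / 2 := by
  simp [evenList]

theorem length_oddList (L : List ℕ) : (oddList L).length = L.length / 2 := by
  simp [oddList]

theorem IsPref.evenList {L : List ℕ} {p : ℕ → ℕ} (h : IsPref L p) :
    IsPref (evenList L) (evenPart p) := by
  refine isPref_of_getElem fun a ha => ?_
  rw [length_evenList] at ha
  simp only [TTE.evenList, List.getElem_map, List.getElem_range]
  exact h.getD (by omega) 0

theorem IsPref.oddList {L : List ℕ} {p : ℕ → ℕ} (h : IsPref L p) :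
    IsPref (oddList L) (oddPart p) := by
  refine isPref_of_getElem fun a ha => ?_
  rw [length_oddList] at ha
  simp only [TTE.oddList, List.getElem_map, List.getElem_range]
  exact h.getD (by omega) 0

/-! ### Tables -/

/-- The pair of an output index and an input prefix that a table entry belongs to. The same coding
serves for the indices of the pieces of a function. -/
abbrev dec (c : ℕ) : ℕ × List ℕ := Denumerable.ofNat (ℕ × List ℕ) c

@[simp]
theorem dec_encode (x : ℕ × List ℕ) : dec (encode x) = x := Denumerable.ofNat_encode x

theorem le_encode_fst (n : ℕ) (l : List ℕ) : n ≤ encode (n, l) := Nat.left_le_pair _ _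

theorem length_le_encode_snd (n : ℕ) (l : List ℕ) : l.length ≤ encode (n, l) :=
  (length_le_encode l).trans (Nat.right_le_pair _ _)

theorem fst_dec_le (c : ℕ) : (dec c).1 ≤ c := by
  have := le_encode_fst (dec c).1 (dec c).2
  rwa [Prod.mk.eta, Denumerable.encode_ofNat] at this

/-- The table of the function that reads the first `β n` symbols of its input and then outputs, as
its `n`-th symbol, the value of `T` at the code of `n` and these symbols. -/
def delay (β T : ℕ → ℕ) (c : ℕ) : ℕ :=
  if (dec c).2.length < β (dec c).1 then 0 else T c + 1

theorem applies_delay (β T q : ℕ → ℕ) :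
    Applies (delay β T) q fun n => T (encode (n, pref q (β n))) := by
  refine fun n => ⟨β n, fun j hj => ?_, ?_⟩
  · simp [delay, length_pref, hj]
  · simp [delay, length_pref]

open Classical in
/-- The table of a function into Sierpinski space that outputs a nonzero symbol when the test `R`
succeeds on a prefix of the input. -/
noncomputable def testTable (R : ℕ → Prop) : ℕ → ℕ := delay Nat.succ fun c => if R c then 1 else 0

theorem testTable_congr {R R' : ℕ → Prop} {c : ℕ} (h : R c ↔ R' c) :
    testTable R c = testTable R' c := by
  by_cases hR : R c
  · simp [testTable, delay, hR, h.1 hR]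
  · simp [testTable, delay, hR, mt h.2 hR]

/-- An entry of the table depends on the test at that position only. -/
theorem testTable_diagonal (R : ℕ → ℕ → Prop) :
    (fun c => testTable (R c) c) = testTable fun c => R c c :=
  funext fun _ => testTable_congr Iff.rfl

theorem realizes_testTable {X : Type*} [RepSpace X] {R : ℕ → Prop} {U : Set X}
    (h : ∀ x q, IsName q x → ((∃ t, R (encode (t, pref q (t + 1)))) ↔ x ∈ U)) :
    Realizes (testTable R) (charFun U) := by
  classical
  refine fun x q hq => ⟨_, applies_delay _ _ q, ?_⟩
  change (∃ n, _ ≠ 0) ↔ x ∈ U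
  rw [← h x q hq]
  exact exists_congr fun n => by by_cases hR : R (encode (n, pref q (n + 1))) <;>
    simp only [Nat.succ_eq_add_one, hR] <;> simp

/-- If the search for each output symbol succeeds, then the application is defined. -/
theorem exists_applies {p q : ℕ → ℕ} (h : ∀ n : ℕ, ∃ k, p (encode (n, pref q k)) ≠ 0) :
    ∃ r, Applies p q r ∧ ∀ n : ℕ, ∃ k, p (encode (n, pref q k)) = r n + 1 := by
  classical
  refine ⟨fun n => p (encode (n, pref q (Nat.find (h n)))) - 1, fun n => ⟨Nat.find (h n), ?_, ?_⟩,
    fun n => ⟨Nat.find (h n), ?_⟩⟩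
  · exact fun j hj => not_not.1 (Nat.find_min (h n) hj)
  all_goals exact (Nat.succ_pred_eq_of_ne_zero (Nat.find_spec (h n))).symm

/-- The table of a function that maps a name of a natural number `N` to the pair of the sequences
`A N` and `B N`. -/
def pairTable (A B : ℕ → ℕ → ℕ) : ℕ → ℕ :=
  delay (fun _ => 1) fun c =>
    if (dec c).1 % 2 = 0 then A (dec c).2.headI ((dec c).1 / 2)
    else B (dec c).2.headI ((dec c).1 / 2)

/-- The sequences `A` and `B` may depend on the position of the entry in the table. -/
theorem applies_pairTable (A B : ℕ → ℕ → ℕ → ℕ) (q : ℕ → ℕ) :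
    ∃ r, Applies (fun c => pairTable (A c) (B c) c) q r ∧
      (evenPart r = fun m => A (encode (2 * m, pref q 1)) (q 0) m) ∧
      oddPart r = fun m => B (encode (2 * m + 1, pref q 1)) (q 0) m := by
  have hhead : (pref q 1).headI = q 0 := by simp [pref]
  refine ⟨_, applies_delay (fun _ => 1) (fun c =>
    if (dec c).1 % 2 = 0 then A c (dec c).2.headI ((dec c).1 / 2)
    else B c (dec c).2.headI ((dec c).1 / 2)) q, ?_, ?_⟩
  · funext m
    have h1 : 2 * m % 2 = 0 := by omega
    have h2 : 2 * m / 2 = m := by omega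
    simp only [evenPart, dec_encode, h1, h2, hhead, if_true]
  · funext m
    have h1 : (2 * m + 1) % 2 ≠ 0 := by omega
    have h2 : (2 * m + 1) / 2 = m := by omega
    simp only [oddPart, dec_encode, h1, h2, hhead, if_false]

/-- Acceptance by a finite part of a name of a point of Sierpinski space. -/
def Accepts (L : List ℕ) : Prop := ∃ v ∈ L, v ≠ 0

theorem Accepts.exists_ne_zero {L : List ℕ} {v : ℕ → ℕ} (h : Accepts L) (hL : IsPref L v) :
    ∃ t, v t ≠ 0 := by
  obtain ⟨a, ha, ha0⟩ := h
  obtain ⟨t, ht, rfl⟩ := List.getElem_of_mem ha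
  have h1 := hL.getElem? ht
  rw [List.getElem?_eq_getElem ht] at h1
  exact ⟨t, Option.some.inj h1 ▸ ha0⟩

theorem accepts_of_ne_zero {L : List ℕ} {v : ℕ → ℕ} (hL : IsPref L v) {t : ℕ} (ht : t < L.length)
    (hv : v t ≠ 0) : Accepts L := by
  have h1 := hL.getElem? ht
  rw [List.getElem?_eq_getElem ht] at h1
  exact ⟨L[t], List.getElem_mem ht, Option.some.inj h1 ▸ hv⟩

section Open

variable {X : Type*} [RepSpace X] {p q : ℕ → ℕ} {U : Set X} {x : X}

theorem mem_of_accepts (hp : Realizes p (charFun U)) (hq : IsName q x) {P Q : List ℕ}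
    (hP : IsPref P p) (hQ : IsPref Q q) (h : Accepts (applyList P Q)) : x ∈ U := by
  obtain ⟨r, hr, hrU⟩ := hp x q hq
  exact hrU.1 (h.exists_ne_zero (applyList_sound hr hP hQ))

theorem exists_accepts (hp : Realizes p (charFun U)) (hq : IsName q x) (hx : x ∈ U) :
    ∃ K, ∀ P Q, IsPref P p → IsPref Q q → K ≤ P.length → K ≤ Q.length →
      Accepts (applyList P Q) := by
  obtain ⟨r, hr, hrU⟩ := hp x q hq
  obtain ⟨t, ht⟩ := hrU.2 hx
  obtain ⟨K, hK⟩ := applyList_complete hr (t + 1)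
  exact ⟨K, fun P Q hP hQ hKP hKQ =>
    accepts_of_ne_zero (applyList_sound hr hP hQ) (hK P Q hP hQ hKP hKQ) ht⟩

end Open

/-! ### Primitive recursiveness -/

section Primrec

variable {α : Type*} [Primcodable α]

theorem primrec_pow : Primrec₂ ((· ^ ·) : ℕ → ℕ → ℕ) :=
  Primrec₂.unpaired'.1 Nat.Primrec.pow

theorem primrec_applyVal : Primrec fun a : (List ℕ × List ℕ) × ℕ => applyVal a.1.1 a.1.2 a.2 := by
  have h : Primrec₂ fun (a : (List ℕ × List ℕ) × ℕ) (j : ℕ) =>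
      a.1.1[encode (a.2, a.1.2.take j)]? :=
    Primrec.list_getElem?.comp (Primrec.fst.comp (Primrec.fst.comp Primrec.fst))
      (Primrec.encode.comp (Primrec.pair (Primrec.snd.comp Primrec.fst)
        (Primrec.list_take.comp Primrec.snd (Primrec.snd.comp (Primrec.fst.comp Primrec.fst)))))
  have h2 : Primrec₂ fun (a : (List ℕ × List ℕ) × ℕ) (j : ℕ) =>
      decide (a.1.1[encode (a.2, a.1.2.take j)]? ≠ some 0) :=
    (PrimrecPred.not (Primrec.eq.comp h (Primrec.const (some 0)))).decide
  exact Primrec.option_getD.comp (h.comp Primrec.id (Primrec.list_findIdx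
    (Primrec.list_range.comp (Primrec.succ.comp (Primrec.list_length.comp
      (Primrec.snd.comp Primrec.fst)))) h2)) (Primrec.const 0)

theorem primrec_applyList {P Q : α → List ℕ} (hP : Primrec P) (hQ : Primrec Q) :
    Primrec fun a => applyList (P a) (Q a) := by
  have h : Primrec₂ fun (a : α) (n : ℕ) => applyVal (P a) (Q a) n :=
    primrec_applyVal.comp (Primrec.pair (Primrec.pair (hP.comp Primrec.fst) (hQ.comp Primrec.fst))
      Primrec.snd)
  exact Primrec.list_map (Primrec.list_range.comp (Primrec.list_findIdx
    (Primrec.list_range.comp (Primrec.list_length.comp hQ))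
    (Primrec.eq.comp h (Primrec.const 0)).decide))
    (Primrec.nat_sub.comp h (Primrec.const 1))

theorem primrec_evenList : Primrec evenList :=
  Primrec.list_map (Primrec.list_range.comp (Primrec.nat_div.comp
    (Primrec.succ.comp Primrec.list_length) (Primrec.const 2)))
    ((Primrec.list_getD 0).comp Primrec.fst (Primrec.nat_double.comp Primrec.snd))

theorem primrec_oddList : Primrec oddList :=
  Primrec.list_map (Primrec.list_range.comp (Primrec.nat_div.comp
    Primrec.list_length (Primrec.const 2)))
    ((Primrec.list_getD 0).comp Primrec.fst (Primrec.nat_double_succ.comp Primrec.snd))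

theorem primrec_replicate {k i : α → ℕ} (hk : Primrec k) (hi : Primrec i) :
    Primrec fun a => List.replicate (k a) (i a) :=
  (Primrec.list_map (Primrec.list_range.comp hk) (hi.comp Primrec.fst).to₂).of_eq fun a => by
    simp

theorem primrec_dec : Primrec dec := Primrec.ofNat _

theorem primrec_delay {β T : α → ℕ → ℕ} {c : α → ℕ} (hβ : Primrec₂ β) (hT : Primrec₂ T)
    (hc : Primrec c) : Primrec fun a => delay (β a) (T a) (c a) :=
  Primrec.ite (Primrec.nat_lt.comp
    (Primrec.list_length.comp (Primrec.snd.comp (primrec_dec.comp hc)))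
    (hβ.comp Primrec.id (Primrec.fst.comp (primrec_dec.comp hc))))
    (Primrec.const 0) (Primrec.succ.comp (hT.comp Primrec.id hc))

theorem primrec_testTable {R : α → ℕ → Prop} {c : α → ℕ} (hR : PrimrecRel R) (hc : Primrec c) :
    Primrec fun a => testTable (R a) (c a) := by
  classical
  exact primrec_delay (Primrec.succ.comp Primrec.snd).to₂
    (Primrec.ite hR (Primrec.const 1) (Primrec.const 0)).to₂ hc

theorem primrecPred_exists_lt {R : α → ℕ → Prop} {k : α → ℕ} (hR : PrimrecRel R)
    (hk : Primrec k) : PrimrecPred fun a => ∃ n < k a, R a n :=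
  ((PrimrecRel.exists_mem_list (R := fun n a => R a n)
    (PrimrecRel.comp₂ hR Primrec₂.right Primrec₂.left)).comp
    (Primrec.list_range.comp hk) Primrec.id).of_eq fun a => by simp

theorem primrec_pairTable {A B : α → ℕ → ℕ → ℕ} {c : α → ℕ}
    (hA : Primrec fun z : α × ℕ × ℕ => A z.1 z.2.1 z.2.2)
    (hB : Primrec fun z : α × ℕ × ℕ => B z.1 z.2.1 z.2.2) (hc : Primrec c) :
    Primrec fun a => pairTable (A a) (B a) (c a) := by
  have h1 : Primrec fun z : α × ℕ => (dec z.2).1 :=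
    Primrec.fst.comp (primrec_dec.comp Primrec.snd)
  have h2 : Primrec fun z : α × ℕ => (z.1, (dec z.2).2.headI, (dec z.2).1 / 2) :=
    Primrec.pair Primrec.fst (Primrec.pair
      (Primrec.list_headI.comp (Primrec.snd.comp (primrec_dec.comp Primrec.snd)))
      (Primrec.nat_div.comp h1 (Primrec.const 2)))
  exact primrec_delay (Primrec.const 1).to₂ (Primrec.ite (Primrec.eq.comp
    (Primrec.nat_mod.comp h1 (Primrec.const 2)) (Primrec.const 0)) (hA.comp h2)
    (hB.comp h2)).to₂ hc

theorem primrecPred_accepts : PrimrecPred Accepts :=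
  (PrimrecPred.not (Primrec.eq.comp Primrec.id (Primrec.const 0))).exists_mem_list

end Primrec

/-! ### Comparing distances with dyadic rationals -/

/-- A bounded search through the values of a computable function is primitive recursive, since the
evaluation of a program for a bounded number of steps is. -/
theorem exists_bounded_search {g : ℕ × ℕ × ℕ → ℕ} (hg : Computable g)
    {T : (ℕ × ℕ × ℕ × ℕ) × ℕ × ℕ → Prop} (hT : PrimrecPred T) :
    ∃ R : ℕ × ℕ × ℕ × ℕ → ℕ → Prop, PrimrecRel R ∧ (∀ a s s', s ≤ s' → R a s → R a s') ∧
      ∀ i j M n, (∃ s, R (i, j, M, n) s) ↔ ∃ k, T ((i, j, M, n), k, g (i, j, k)) := by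
  have hg' : Nat.Partrec fun c => Part.some (g (Denumerable.ofNat (ℕ × ℕ × ℕ) c)) :=
    Partrec.nat_iff.1 (hg.comp (Computable.ofNat _)).partrec
  obtain ⟨code, hcode⟩ := Nat.Partrec.Code.exists_code.1 hg'
  have heval : ∀ x v, v ∈ Nat.Partrec.Code.eval code (encode x) ↔ v = g x := fun x v => by
    rw [hcode]
    simp only [Denumerable.ofNat_encode, Part.mem_some_iff]
  let E : ℕ → ℕ × ℕ × ℕ → Option ℕ := fun s x => Nat.Partrec.Code.evaln s code (encode x)
  refine ⟨fun a s => ∃ k < s, ∃ v, E s (a.1, a.2.1, k) = some v ∧ T (a, k, v), ?_, ?_, ?_⟩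
  · refine primrecPred_exists_lt (R := fun (x : (ℕ × ℕ × ℕ × ℕ) × ℕ) (k : ℕ) =>
      ∃ v, E x.2 (x.1.1, x.1.2.1, k) = some v ∧ T (x.1, k, v)) ?_ Primrec.snd
    classical
    have h1 : Primrec fun y : ((ℕ × ℕ × ℕ × ℕ) × ℕ) × ℕ => E y.1.2 (y.1.1.1, y.1.1.2.1, y.2) := by
      refine Nat.Partrec.Code.primrec_evaln.comp (Primrec.pair (Primrec.pair
        (Primrec.snd.comp Primrec.fst) (Primrec.const code)) (Primrec.encode.comp ?_))
      exact Primrec.pair (Primrec.fst.comp (Primrec.fst.comp Primrec.fst))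
        (Primrec.pair (Primrec.fst.comp (Primrec.snd.comp (Primrec.fst.comp Primrec.fst)))
          Primrec.snd)
    have h2 : Primrec₂ fun (y : ((ℕ × ℕ × ℕ × ℕ) × ℕ) × ℕ) (v : ℕ) =>
        decide (T (y.1.1, y.2, v)) := by
      refine PrimrecPred.decide (hT.comp (f := fun z : (((ℕ × ℕ × ℕ × ℕ) × ℕ) × ℕ) × ℕ =>
        (z.1.1.1, z.1.2, z.2)) ?_)
      exact Primrec.pair (Primrec.fst.comp (Primrec.fst.comp Primrec.fst))
        (Primrec.pair (Primrec.snd.comp Primrec.fst) Primrec.snd)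
    have h3 := Primrec.eq.comp (Primrec.option_casesOn h1 (Primrec.const false) h2)
      (Primrec.const true)
    refine h3.of_eq fun y => ?_
    cases h : E y.1.2 (y.1.1.1, y.1.1.2.1, y.2) <;> simp [h]
  · rintro a s s' hs ⟨k, hk, v, hv, hT⟩
    exact ⟨k, hk.trans_le hs, v, Nat.Partrec.Code.evaln_mono hs hv, hT⟩
  · intro i j M n
    constructor
    · rintro ⟨s, k, -, v, hv, hT⟩
      rw [(heval (i, j, k) v).1 (Nat.Partrec.Code.evaln_sound hv)] at hT
      exact ⟨k, hT⟩
    · rintro ⟨k, hT⟩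
      obtain ⟨s, hs⟩ := Nat.Partrec.Code.evaln_complete.1 ((heval (i, j, k) _).2 rfl)
      exact ⟨max s (k + 1), k, by omega, _,
        Nat.Partrec.Code.evaln_mono (le_max_left _ _) hs, hT⟩

theorem exists_one_div_two_pow_lt {ε : ℝ} (hε : 0 < ε) : ∃ k : ℕ, 1 / 2 ^ k < ε := by
  obtain ⟨k, hk⟩ := exists_pow_lt_of_lt_one hε (by norm_num : (1 / 2 : ℝ) < 1)
  exact ⟨k, by rwa [one_div_pow] at hk⟩

/-- The strict upper bounds of distances are enumerated by a primitive recursive relation. -/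
theorem exists_near (X : Type*) [MetricSpace X] [ComputableMetricSpace X] :
    ∃ R : ℕ × ℕ × ℕ × ℕ → ℕ → Prop, PrimrecRel R ∧
      ∀ i j M n, (∃ s, R (i, j, M, n) s) ↔
        dist (denseSeq i : X) (denseSeq j) < (M : ℝ) / 2 ^ n := by
  obtain ⟨g, hg, hdist⟩ := computable_dist (X := X)
  have hT : PrimrecPred fun z : (ℕ × ℕ × ℕ × ℕ) × ℕ × ℕ =>
      (z.2.2 + 1) * 2 ^ z.1.2.2.2 < z.1.2.2.1 * 2 ^ z.2.1 := by
    have h := (Primrec.snd.comp (Primrec.snd.comp Primrec.fst) :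
      Primrec fun z : (ℕ × ℕ × ℕ × ℕ) × ℕ × ℕ => z.1.2.2)
    exact Primrec.nat_lt.comp (Primrec.nat_mul.comp
      (Primrec.succ.comp (Primrec.snd.comp Primrec.snd))
      (primrec_pow.comp (Primrec.const 2) (Primrec.snd.comp h)))
      (Primrec.nat_mul.comp (Primrec.fst.comp h)
      (primrec_pow.comp (Primrec.const 2) (Primrec.fst.comp Primrec.snd)))
  obtain ⟨R, hR, -, hiff⟩ := exists_bounded_search hg hT
  refine ⟨R, hR, fun i j M n => (hiff i j M n).trans ?_⟩
  have key : ∀ k : ℕ, (g (i, j, k) + 1) * 2 ^ n < M * 2 ^ k ↔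
      (g (i, j, k) : ℝ) / 2 ^ k + 1 / 2 ^ k < (M : ℝ) / 2 ^ n := fun k => by
    rw [← add_div, div_lt_div_iff₀ (by positivity) (by positivity)]
    exact_mod_cast Iff.rfl
  constructor
  · rintro ⟨k, hk⟩
    have := (abs_le.1 (hdist i j k)).2
    have := (key k).1 hk
    linarith
  · intro h
    obtain ⟨k, hk⟩ := exists_one_div_two_pow_lt
      (by linarith : 0 < ((M : ℝ) / 2 ^ n - dist (denseSeq i : X) (denseSeq j)) / 2)
    refine ⟨k, (key k).2 ?_⟩
    have := (abs_le.1 (hdist i j k)).1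
    linarith

/-- The strict lower bounds of distances are enumerated by a primitive recursive relation. -/
theorem exists_far (X : Type*) [MetricSpace X] [ComputableMetricSpace X] :
    ∃ R : ℕ × ℕ × ℕ × ℕ → ℕ → Prop, PrimrecRel R ∧ (∀ a s s', s ≤ s' → R a s → R a s') ∧
      ∀ i j M n, (∃ s, R (i, j, M, n) s) ↔
        (M : ℝ) / 2 ^ n < dist (denseSeq i : X) (denseSeq j) := by
  obtain ⟨g, hg, hdist⟩ := computable_dist (X := X)
  have hT : PrimrecPred fun z : (ℕ × ℕ × ℕ × ℕ) × ℕ × ℕ =>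
      z.1.2.2.1 * 2 ^ z.2.1 + 2 ^ z.1.2.2.2 < z.2.2 * 2 ^ z.1.2.2.2 := by
    have h := (Primrec.snd.comp (Primrec.snd.comp Primrec.fst) :
      Primrec fun z : (ℕ × ℕ × ℕ × ℕ) × ℕ × ℕ => z.1.2.2)
    have h2 := primrec_pow.comp (Primrec.const 2) (Primrec.snd.comp h)
    exact Primrec.nat_lt.comp (Primrec.nat_add.comp (Primrec.nat_mul.comp (Primrec.fst.comp h)
      (primrec_pow.comp (Primrec.const 2) (Primrec.fst.comp Primrec.snd))) h2)
      (Primrec.nat_mul.comp (Primrec.snd.comp Primrec.snd) h2)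
  obtain ⟨R, hR, hmono, hiff⟩ := exists_bounded_search hg hT
  refine ⟨R, hR, hmono, fun i j M n => (hiff i j M n).trans ?_⟩
  have key : ∀ k : ℕ, M * 2 ^ k + 2 ^ n < g (i, j, k) * 2 ^ n ↔
      (M : ℝ) / 2 ^ n + 1 / 2 ^ k < (g (i, j, k) : ℝ) / 2 ^ k := fun k => by
    rw [div_add_div _ _ (by positivity) (by positivity),
      div_lt_div_iff₀ (by positivity) (by positivity), mul_one, ← mul_assoc,
      mul_lt_mul_iff_left₀ (by positivity)]
    exact_mod_cast Iff.rfl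
  constructor
  · rintro ⟨k, hk⟩
    have := (abs_le.1 (hdist i j k)).1
    have := (key k).1 hk
    linarith
  · intro h
    obtain ⟨k, hk⟩ := exists_one_div_two_pow_lt
      (by linarith : 0 < (dist (denseSeq i : X) (denseSeq j) - (M : ℝ) / 2 ^ n) / 2)
    refine ⟨k, (key k).2 ?_⟩
    have := (abs_le.1 (hdist i j k)).2
    linarith

/-- `Near X (i, j, M, n) s`: a computation bounded by `s` verifies that the distance of the members
`i` and `j` of the dense sequence of `X` is less than `M / 2 ^ n`. -/
def Near (X : Type*) [MetricSpace X] [ComputableMetricSpace X] : ℕ × ℕ × ℕ × ℕ → ℕ → Prop :=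
  (exists_near X).choose

/-- `Far X (i, j, M, n) s`: a computation bounded by `s` verifies that the distance of the members
`i` and `j` of the dense sequence of `X` is greater than `M / 2 ^ n`. -/
def Far (X : Type*) [MetricSpace X] [ComputableMetricSpace X] : ℕ × ℕ × ℕ × ℕ → ℕ → Prop :=
  (exists_far X).choose

section NearFar

variable (X : Type*) [MetricSpace X] [ComputableMetricSpace X]

theorem primrec_near : PrimrecRel (Near X) := (exists_near X).choose_spec.1

theorem primrec_far : PrimrecRel (Far X) := (exists_far X).choose_spec.1

theorem exists_near_iff (i j M n : ℕ) : (∃ s, Near X (i, j, M, n) s) ↔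
    dist (denseSeq i : X) (denseSeq j) < (M : ℝ) / 2 ^ n :=
  (exists_near X).choose_spec.2 i j M n

theorem exists_far_iff (i j M n : ℕ) : (∃ s, Far X (i, j, M, n) s) ↔
    (M : ℝ) / 2 ^ n < dist (denseSeq i : X) (denseSeq j) :=
  (exists_far X).choose_spec.2.2 i j M n

variable {X} in
theorem Far.mono {a : ℕ × ℕ × ℕ × ℕ} {s s' : ℕ} (h : Far X a s) (hs : s ≤ s') : Far X a s' :=
  (exists_far X).choose_spec.2.1 a s s' hs h

end NearFar

/-! ### Unions of sequences of balls -/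

section Balls

variable (Y : Type*) [MetricSpace Y] [ComputableMetricSpace Y]

/-- The ball with code `V = ⟨c, ρ⟩`: its centre is the member `c` of the dense sequence and its
radius is `2 ^ (-ρ)`. -/
def ball (V : ℕ) : Set Y := Metric.ball (denseSeq V.unpair.1) (1 / 2 ^ V.unpair.2)

/-- The open set enumerated by `e`: the entry `V + 1` contributes the ball with code `V`, and the
entry `0` contributes nothing. -/
def ballsUnion (e : ℕ → ℕ) : Set Y := {y | ∃ n V, e n = V + 1 ∧ y ∈ ball Y V}

/-- The test that the point named by an input belongs to the ball with code `v - 1`, performed at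
the table position `c`, whose output index `⟨a, ⟨b, s⟩⟩` says that the `b`-th input symbol is used
and that the computation is bounded by `s`. The bound on the distance of the centre from that symbol
is the difference of the radius and `2 ^ (-b)`; the truncated subtraction makes it `0`, which no
distance is below, if this difference is negative. -/
def UnionTest (v c : ℕ) : Prop :=
  v ≠ 0 ∧ Near Y ((dec c).2.getD (dec c).1.unpair.2.unpair.1 0, (v - 1).unpair.1,
    2 ^ (dec c).1.unpair.2.unpair.1 - 2 ^ (v - 1).unpair.2,
    (dec c).1.unpair.2.unpair.1 + (v - 1).unpair.2) (dec c).1.unpair.2.unpair.2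

/-- A name of the open set `ballsUnion Y e`. -/
noncomputable def unionTable (e : ℕ → ℕ) : ℕ → ℕ :=
  testTable fun c => UnionTest Y (e (dec c).1.unpair.1) c

/-- The prefix of a name of `ballsUnion Y e` that is determined by the prefix `E` of `e`. -/
noncomputable def unionList (E : List ℕ) : List ℕ :=
  (List.range E.length).map (unionTable Y fun a => E.getD a 0)

variable {Y}

theorem mem_ball_iff {q : ℕ → ℕ} {y : Y} (hq : IsName q y) (V : ℕ) :
    y ∈ ball Y V ↔ ∃ b, dist (denseSeq (q b) : Y) (denseSeq V.unpair.1) <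
      ((2 ^ b - 2 ^ V.unpair.2 : ℕ) : ℝ) / 2 ^ (b + V.unpair.2) := by
  have key : ∀ b, V.unpair.2 ≤ b → ((2 ^ b - 2 ^ V.unpair.2 : ℕ) : ℝ) / 2 ^ (b + V.unpair.2) =
      1 / 2 ^ V.unpair.2 - 1 / 2 ^ b := fun b hb => by
    rw [Nat.cast_sub (Nat.pow_le_pow_right (by norm_num) hb)]
    push_cast
    rw [pow_add]
    field_simp
  rw [ball, Metric.mem_ball, dist_comm]
  constructor
  · intro h
    obtain ⟨b, hb⟩ := exists_one_div_two_pow_lt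
      (by linarith : 0 < (1 / 2 ^ V.unpair.2 - dist (denseSeq V.unpair.1) y) / 2)
    have hb' : V.unpair.2 ≤ b := by
      by_contra! hlt
      have h1 : (1 : ℝ) / 2 ^ V.unpair.2 ≤ 1 / 2 ^ b :=
        one_div_le_one_div_of_le (by positivity) (pow_le_pow_right₀ (by norm_num) hlt.le)
      have h2 := dist_nonneg (x := (denseSeq V.unpair.1 : Y)) (y := y)
      have h3 : (0 : ℝ) < 1 / 2 ^ b := by positivity
      linarith
    refine ⟨b, ?_⟩
    rw [key b hb']
    have h1 := hq b
    have h2 := dist_triangle_right (denseSeq (q b) : Y) (denseSeq V.unpair.1) y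
    linarith
  · rintro ⟨b, hb⟩
    have hb' : V.unpair.2 ≤ b := by
      by_contra! hlt
      rw [Nat.sub_eq_zero_of_le (Nat.pow_le_pow_right (by norm_num) hlt.le), Nat.cast_zero,
        zero_div] at hb
      exact absurd hb (not_lt.2 dist_nonneg)
    rw [key b hb'] at hb
    have h1 := hq b
    have h2 := dist_triangle_left (denseSeq V.unpair.1 : Y) y (denseSeq (q b))
    linarith

theorem realizes_unionTable (e : ℕ → ℕ) : Realizes (unionTable Y e) (charFun (ballsUnion Y e)) := by
  refine realizes_testTable fun y q hq => ?_
  constructor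
  · rintro ⟨t, hv, hnear⟩
    simp only [dec_encode] at hv hnear
    obtain ⟨V, hV⟩ := Nat.exists_eq_succ_of_ne_zero hv
    refine ⟨t.unpair.1, V, hV, (mem_ball_iff hq V).2 ⟨t.unpair.2.unpair.1, ?_⟩⟩
    rw [hV, Nat.succ_eq_add_one, Nat.add_sub_cancel, (isPref_pref q (t + 1)).getD] at hnear
    · exact (exists_near_iff Y _ _ _ _).1 ⟨_, hnear⟩
    · rw [length_pref]
      exact Nat.lt_succ_of_le ((Nat.unpair_left_le _).trans (Nat.unpair_right_le _))
  · rintro ⟨a, V, hV, hy⟩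
    obtain ⟨b, hb⟩ := (mem_ball_iff hq V).1 hy
    obtain ⟨s, hs⟩ := (exists_near_iff Y _ _ _ _).2 hb
    refine ⟨Nat.pair a (Nat.pair b s), ?_⟩
    simp only [UnionTest, dec_encode, Nat.unpair_pair, hV]
    refine ⟨by simp, ?_⟩
    rw [Nat.add_sub_cancel, (isPref_pref q _).getD]
    · exact hs
    · rw [length_pref]
      exact Nat.lt_succ_of_le ((Nat.left_le_pair _ _).trans (Nat.right_le_pair _ _))

theorem length_unionList (E : List ℕ) : (unionList Y E).length = E.length := by
  simp [unionList]

theorem IsPref.unionList {E : List ℕ} {e : ℕ → ℕ} (h : IsPref E e) :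
    IsPref (unionList Y E) (unionTable Y e) := by
  refine isPref_of_getElem fun c hc => ?_
  rw [length_unionList] at hc
  have h1 := h.getD (((Nat.unpair_left_le _).trans (fst_dec_le c)).trans_lt hc) 0
  have h2 : (TTE.unionList Y E)[c] = unionTable Y (fun a => E.getD a 0) c := by
    simp [TTE.unionList]
  rw [h2]
  exact testTable_congr (by simp only [h1])

theorem primrec_unionList : Primrec (unionList Y) := by
  have hd : Primrec fun z : ℕ × ℕ => dec z.2 := primrec_dec.comp Primrec.snd
  have hbs : Primrec fun z : ℕ × ℕ => (dec z.2).1.unpair.2.unpair :=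
    Primrec.unpair.comp (Primrec.snd.comp (Primrec.unpair.comp (Primrec.fst.comp hd)))
  have hV : Primrec fun z : ℕ × ℕ => (z.1 - 1).unpair :=
    Primrec.unpair.comp (Primrec.nat_sub.comp Primrec.fst (Primrec.const 1))
  have htest : PrimrecRel (UnionTest Y) := by
    refine PrimrecPred.and (PrimrecPred.not (Primrec.eq.comp Primrec.fst (Primrec.const 0)))
      ((primrec_near Y).comp (Primrec.pair ?_ (Primrec.pair (Primrec.fst.comp hV)
        (Primrec.pair ?_ ?_))) (Primrec.snd.comp hbs))
    · exact (Primrec.list_getD 0).comp (Primrec.snd.comp hd) (Primrec.fst.comp hbs)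
    · exact Primrec.nat_sub.comp (primrec_pow.comp (Primrec.const 2) (Primrec.fst.comp hbs))
        (primrec_pow.comp (Primrec.const 2) (Primrec.snd.comp hV))
    · exact Primrec.nat_add.comp (Primrec.fst.comp hbs) (Primrec.snd.comp hV)
  refine Primrec.list_map (Primrec.list_range.comp Primrec.list_length)
    (primrec_testTable (R := fun (z : List ℕ × ℕ) c =>
      UnionTest Y (z.1.getD (dec c).1.unpair.1 0) c) ?_ Primrec.snd)
  refine htest.comp ((Primrec.list_getD 0).comp (Primrec.fst.comp Primrec.fst) (Primrec.fst.comp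
    (Primrec.unpair.comp (Primrec.fst.comp (primrec_dec.comp Primrec.snd))))) Primrec.snd

end Balls

/-! ### Preimages of unions of balls -/

section Preimage

variable {X Y : Type*} [RepSpace X] [MetricSpace Y] [ComputableMetricSpace Y]

variable (Y) in
/-- If `P`, `E` and `Q` are prefixes of a name `p` of a preimage map, of a sequence `e` of balls and
of a name of `x`, then `MemStage Y P E Q i` says that these prefixes suffice to verify that `x`
belongs to the `i`-th open set in the intersection that `p` produces for the preimage of the union
of `e`. -/
def MemStage (P E Q : List ℕ) (i : ℕ) : Prop :=
  Accepts (applyList (oddList (applyList (applyList P (unionList Y E))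
    (List.replicate P.length i))) Q)

variable (Y) in
/-- The membership relation of the sets `W e i` is semidecided by `MemStage` with the oracle `p`. -/
def IsSemidecided (p : ℕ → ℕ) (W : (ℕ → ℕ) → ℕ → Set X) : Prop :=
  ∀ e i x q, IsName q x →
    (∀ P E Q, IsPref P p → IsPref E e → IsPref Q q → MemStage Y P E Q i → x ∈ W e i) ∧
    (x ∈ W e i → ∃ K, ∀ P E Q, IsPref P p → IsPref E e → IsPref Q q →
      K ≤ P.length → K ≤ E.length → K ≤ Q.length → MemStage Y P E Q i)

theorem exists_preimage_sets {p : ℕ → ℕ} {f : X → Y} {g : ContFun (OpenSet Y) (Delta2Set X)}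
    (hp : Realizes p g.toFun) (hg : IsPreimageMap g f) :
    ∃ W : (ℕ → ℕ) → ℕ → Set X, (∀ e, f ⁻¹' ballsUnion Y e = ⋂ i, W e i) ∧
      IsSemidecided Y p W := by
  have h1 : ∀ e, ∃ σ, Applies p (unionTable Y e) σ ∧ ∃ s : ContFun ℕ (ClosedSet X × OpenSet X),
      Realizes σ s.toFun ∧ Delta2Presents s (f ⁻¹' ballsUnion Y e) := by
    intro e
    obtain ⟨σ, hσ, s, hs, hsD⟩ := hp ⟨ballsUnion Y e, _, realizes_unionTable e⟩ _
      (realizes_unionTable e)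
    rw [hg] at hsD
    exact ⟨σ, hσ, s, hs, hsD⟩
  choose σ hσ s hs hsD using h1
  have h2 : ∀ e i, ∃ r, Applies (σ e) (fun _ => i) r ∧
      Realizes (oddPart r) (charFun ((s e).toFun i).2.carrier) := by
    intro e i
    obtain ⟨r, hr, hr'⟩ := hs e i (fun _ => i) rfl
    exact ⟨r, hr, hr'.2⟩
  choose r hr hrU using h2
  refine ⟨fun e i => ((s e).toFun i).2.carrier, fun e => (hsD e).2, fun e i x q hq => ⟨?_, ?_⟩⟩
  · intro P E Q hP hE hQ hstage
    exact mem_of_accepts (hrU e i) hq (applyList_sound (hr e i)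
      (applyList_sound (hσ e) hP hE.unionList) (isPref_replicate _ _)).oddList hQ hstage
  · intro hx
    obtain ⟨K₁, hK₁⟩ := exists_accepts (hrU e i) hq hx
    obtain ⟨K₂, hK₂⟩ := applyList_complete (hr e i) (2 * K₁)
    obtain ⟨K₃, hK₃⟩ := applyList_complete (hσ e) K₂
    refine ⟨max K₁ (max K₂ K₃), fun P E Q hP hE hQ hKP hKE hKQ => ?_⟩
    simp only [max_le_iff] at hKP hKE hKQ
    have hσ' := applyList_sound (hσ e) hP (hE.unionList (Y := Y))
    have hi := isPref_replicate P.length i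
    refine hK₁ _ _ (applyList_sound (hr e i) hσ' hi).oddList hQ ?_ hKQ.1
    rw [length_oddList, Nat.le_div_iff_mul_le two_pos, mul_comm]
    refine hK₂ _ _ hσ' hi (hK₃ _ _ hP hE.unionList hKP.2.2 ?_) ?_
    · rw [length_unionList]
      exact hKE.2.2
    · rw [List.length_replicate]
      exact hKP.2.1

theorem primrecPred_memStage {α : Type*} [Primcodable α] {P E Q : α → List ℕ} {i : α → ℕ}
    (hP : Primrec P) (hE : Primrec E) (hQ : Primrec Q) (hi : Primrec i) :
    PrimrecPred fun a => MemStage Y (P a) (E a) (Q a) (i a) :=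
  primrecPred_accepts.comp (primrec_applyList (primrec_oddList.comp (primrec_applyList
    (primrec_applyList hP (primrec_unionList.comp hE))
    (primrec_replicate (Primrec.list_length.comp hP) hi))) hQ)

end Preimage

/-! ### The closed pieces of a measurable function -/

/-- The sequence of balls that begins with `w` and goes on with the ball `V` for ever. -/
def ballSeq (w : List ℕ) (V : ℕ) : ℕ → ℕ := fun n => w.getD n (V + 1)

/-- A prefix of `ballSeq w V` that contains `w`. -/
def ballList (w : List ℕ) (V t : ℕ) : List ℕ := w ++ List.replicate t (V + 1)

theorem isPref_ballList (w : List ℕ) (V t : ℕ) : IsPref (ballList w V t) (ballSeq w V) := by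
  refine isPref_of_getElem fun a ha => ?_
  simp only [ballList, ballSeq, List.getD_eq_getElem?_getD]
  rw [List.getElem_append]
  split_ifs with h
  · simp [h]
  · simp [List.getElem?_eq_none (not_lt.1 h)]

theorem le_length_ballList (w : List ℕ) (V t : ℕ) : t ≤ (ballList w V t).length := by
  simp [ballList]

theorem primrec_ballList {α : Type*} [Primcodable α] {w : α → List ℕ} {V t : α → ℕ}
    (hw : Primrec w) (hV : Primrec V) (ht : Primrec t) :
    Primrec fun a => ballList (w a) (V a) (t a) :=
  Primrec.list_append.comp hw (primrec_replicate ht (Primrec.succ.comp hV))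

section Pieces

variable {X Y : Type*} [MetricSpace Y] [ComputableMetricSpace Y]

theorem mem_ballsUnion_ballSeq {y : Y} {V : ℕ} (h : y ∈ ball Y V) (w : List ℕ) :
    y ∈ ballsUnion Y (ballSeq w V) :=
  ⟨w.length, V, by simp [ballSeq], h⟩

variable (Y) in
/-- The distance of the centres of the balls `V` and `V'` is greater than the sum of their radii. -/
def Apart (V V' : ℕ) : Prop :=
  (1 / 2 ^ V.unpair.2 + 1 / 2 ^ V'.unpair.2 : ℝ) <
    dist (denseSeq V.unpair.1 : Y) (denseSeq V'.unpair.1)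

theorem Apart.notMem {V V' : ℕ} (h : Apart Y V V') {y : Y} (hy : y ∈ ball Y V) :
    y ∉ ball Y V' := by
  intro hy'
  rw [ball, Metric.mem_ball] at hy hy'
  have h1 := dist_triangle_left (denseSeq V.unpair.1 : Y) (denseSeq V'.unpair.1) y
  rw [Apart] at h
  linarith

variable (Y) in
/-- A computation bounded by `t` verifies that `V` and `V'` are apart. -/
def ApartStage (V V' t : ℕ) : Prop :=
  Far Y (V.unpair.1, V'.unpair.1, 2 ^ V.unpair.2 + 2 ^ V'.unpair.2,
    V.unpair.2 + V'.unpair.2) t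

theorem exists_apartStage_iff (V V' : ℕ) : (∃ t, ApartStage Y V V' t) ↔ Apart Y V V' := by
  refine (exists_far_iff Y _ _ _ _).trans ?_
  have h : ((2 ^ V.unpair.2 + 2 ^ V'.unpair.2 : ℕ) : ℝ) / 2 ^ (V.unpair.2 + V'.unpair.2) =
      1 / 2 ^ V.unpair.2 + 1 / 2 ^ V'.unpair.2 := by
    push_cast
    rw [pow_add]
    field_simp
    ring
  rw [h, Apart]

variable (Y) in
/-- The `N`-th piece, where `N` codes an index `i` and a finite sequence `w` of balls: the points at
which the sets `W (ballSeq w V) i`, regarded as a description of the balls `V` that contain the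
value of `f`, are consistent. -/
def piece (W : (ℕ → ℕ) → ℕ → Set X) (N : ℕ) : Set X :=
  {x | ∀ V V', Apart Y V V' → x ∈ W (ballSeq (dec N).2 V) (dec N).1 →
    x ∉ W (ballSeq (dec N).2 V') (dec N).1}

/-- On a piece, every ball in the description contains the value of `f` up to its boundary, since
every ball around this value belongs to the description as well. -/
theorem dist_le_of_mem_piece {f : X → Y} {W : (ℕ → ℕ) → ℕ → Set X}
    (hW : ∀ e, f ⁻¹' ballsUnion Y e = ⋂ i, W e i) {N : ℕ} {x : X} (hx : x ∈ piece Y W N) {V : ℕ}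
    (hV : x ∈ W (ballSeq (dec N).2 V) (dec N).1) :
    dist (denseSeq V.unpair.1) (f x) ≤ 1 / 2 ^ V.unpair.2 := by
  by_contra! hlt
  obtain ⟨k, hk⟩ := exists_one_div_two_pow_lt
    (by linarith : 0 < (dist (denseSeq V.unpair.1) (f x) - 1 / 2 ^ V.unpair.2) / 2)
  obtain ⟨c, hc⟩ := (denseRange (X := Y)).exists_dist_lt (f x)
    (by positivity : (0 : ℝ) < 1 / 2 ^ k)
  have hball : f x ∈ ball Y (Nat.pair c k) := by simpa [ball] using hc
  have hmem : x ∈ f ⁻¹' ballsUnion Y (ballSeq (dec N).2 (Nat.pair c k)) :=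
    mem_ballsUnion_ballSeq hball _
  rw [hW] at hmem
  refine hx V (Nat.pair c k) ?_ hV (Set.mem_iInter.1 hmem _)
  have h1 := dist_triangle_right (denseSeq V.unpair.1) (f x) (denseSeq c)
  rw [Apart, Nat.unpair_pair]
  simp only
  linarith

variable [RepSpace X]

/-- The pieces cover the space. Otherwise, a sequence of balls that avoid the value of `f` at a
point `x` could be built, by finite extension, so that finitely many of its entries verify for each
`i` that `x` is in the `i`-th open set; then `x` would be in the preimage of the union of these
balls. -/
theorem exists_mem_piece {p : ℕ → ℕ} {f : X → Y} {W : (ℕ → ℕ) → ℕ → Set X}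
    (hW : ∀ e, f ⁻¹' ballsUnion Y e = ⋂ i, W e i) (hp : IsSemidecided Y p W) (x : X) :
    ∃ N, x ∈ piece Y W N := by
  by_contra! hcon
  obtain ⟨q, hq⟩ := exists_name x
  let Avoid : List ℕ → Prop := fun w => ∀ v ∈ w, ∀ V, v = V + 1 → f x ∉ ball Y V
  have hstep : ∀ (w : {w // Avoid w}) (i : ℕ), ∃ w' : {w // Avoid w}, w.1 <+: w'.1 ∧
      w.1.length < w'.1.length ∧ ∀ e, IsPref w'.1 e → x ∈ W e i := by
    rintro ⟨w, hw⟩ i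
    -- Of two balls in the description that are apart, at least one avoids `f x`.
    have hV : ∃ V, f x ∉ ball Y V ∧ x ∈ W (ballSeq w V) i := by
      have h := hcon (encode (i, w))
      simp only [piece, Set.mem_ofPred_eq, dec_encode] at h
      push Not at h
      obtain ⟨V, V', hap, h1, h2⟩ := h
      by_cases hy : f x ∈ ball Y V
      · exact ⟨V', hap.notMem hy, h2⟩
      · exact ⟨V, hy, h1⟩
    obtain ⟨V, hyV, hxV⟩ := hV
    obtain ⟨K, hK⟩ := (hp _ i x q hq).2 hxV
    -- With `K + 1` instead of `K` copies the extension is proper, so that the limit is total.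
    refine ⟨⟨ballList w V (K + 1), ?_⟩, List.prefix_append _ _, by simp [ballList], fun e he => ?_⟩
    · intro v hv V₁ hV₁
      rcases List.mem_append.1 hv with hv | hv
      · exact hw v hv V₁ hV₁
      · have := List.eq_of_mem_replicate hv
        obtain rfl : V₁ = V := by omega
        exact hyV
    · refine (hp e i x q hq).1 _ _ _ (isPref_pref p K) he (isPref_pref q K)
        (hK _ _ _ (isPref_pref p K) (isPref_ballList w V (K + 1)) (isPref_pref q K) ?_ ?_ ?_)
      · rw [length_pref]
      · exact (Nat.le_succ K).trans (le_length_ballList w V (K + 1))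
      · rw [length_pref]
  choose next hpre hlen hnext using hstep
  let w : ℕ → {w // Avoid w} := fun n => Nat.rec ⟨[], by simp [Avoid]⟩ (fun i v => next v i) n
  have hwpre : ∀ m n, m ≤ n → (w m).1 <+: (w n).1 := by
    intro m n hmn
    induction n, hmn using Nat.le_induction with
    | base => exact List.prefix_refl _
    | succ n _ ih => exact ih.trans (hpre (w n) n)
  have hwlen : ∀ n, n ≤ (w n).1.length := by
    intro n
    induction n with
    | zero => exact Nat.zero_le _
    | succ n ih => exact lt_of_le_of_lt ih (hlen (w n) n)
  have hget : ∀ m n a, a < (w m).1.length → a < (w n).1.length →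
      (w m).1.getD a 0 = (w n).1.getD a 0 := by
    intro m n a hm hn
    rw [List.getD_eq_getElem _ _ hm, List.getD_eq_getElem _ _ hn]
    rcases le_total m n with h | h
    · exact (hwpre m n h).getElem hm
    · exact ((hwpre n m h).getElem hn).symm
  let e : ℕ → ℕ := fun n => (w (n + 1)).1.getD n 0
  have he : ∀ n, IsPref (w n).1 e := fun n => isPref_of_getElem fun a ha => by
    rw [← List.getD_eq_getElem _ 0 ha]
    exact hget n (a + 1) a ha (hwlen (a + 1))
  have hx : x ∈ f ⁻¹' ballsUnion Y e := by
    rw [hW]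
    exact Set.mem_iInter.2 fun i => hnext (w i) i e (he (i + 1))
  obtain ⟨n, V, hnV, hyV⟩ := hx
  refine (w (n + 1)).2 (e n) ?_ V hnV hyV
  have h1 := hwlen (n + 1)
  change (w (n + 1)).1.getD n 0 ∈ _
  rw [List.getD_eq_getElem _ _ h1]
  exact List.getElem_mem _

end Pieces

/-! ### Names of the pieces and of the restrictions -/

section Tables

variable (Y : Type*) [MetricSpace Y] [ComputableMetricSpace Y]

/-- The test, performed at the table position `c`, that a point is outside the piece `N`. -/
def OutsideTest (P : List ℕ) (N c : ℕ) : Prop :=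
  ∃ V < (dec c).1, ∃ V' < (dec c).1, ApartStage Y V V' (dec c).1 ∧
    MemStage Y P (ballList (dec N).2 V (dec c).1) (dec c).2 (dec N).1 ∧
    MemStage Y P (ballList (dec N).2 V' (dec c).1) (dec c).2 (dec N).1

/-- The test, performed at the table position `c`, that the ball of radius `2 ^ (-(t + 1))` around
the member `k` of the dense sequence is in the description of the value on the piece `N`, where `t`
is the output index of `c`. -/
def ValueTest (P : List ℕ) (N c k : ℕ) : Prop :=
  MemStage Y P (ballList (dec N).2 (Nat.pair k ((dec c).1 + 1)) (dec c).2.length) (dec c).2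
    (dec N).1

open Classical in
/-- The table of a realizer of the restriction to the piece `N`. -/
noncomputable def valueTable (P : List ℕ) (N c : ℕ) : ℕ :=
  if (List.range (dec c).2.length).findIdx (fun k => decide (ValueTest Y P N c k)) <
      (dec c).2.length then
    (List.range (dec c).2.length).findIdx (fun k => decide (ValueTest Y P N c k)) + 1
  else 0

/-- The table of a realizer that maps a name of a function in `Delta2Fun` to the name of its
decomposition into pieces. -/
noncomputable def decompositionTable : ℕ → ℕ :=
  delay id fun c => pairTable
    (fun N => testTable fun c' => OutsideTest Y (dec c).2 N c')
    (fun N => valueTable Y (dec c).2 N) (dec c).1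

variable {Y}

theorem primrec_decompositionTable : Primrec (decompositionTable Y) := by
  classical
  suffices h : Primrec fun z : ℕ × ℕ => pairTable
      (fun N => testTable fun c' => OutsideTest Y (dec z.2).2 N c')
      (fun N => valueTable Y (dec z.2).2 N) (dec z.2).1 from
    primrec_delay (α := ℕ) (β := fun _ => id) Primrec.snd.to₂ h.to₂ Primrec.id
  refine primrec_pairTable
    (A := fun z : ℕ × ℕ => fun N => testTable fun c' => OutsideTest Y (dec z.2).2 N c')
    (B := fun z : ℕ × ℕ => fun N => valueTable Y (dec z.2).2 N) ?_ ?_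
    (Primrec.fst.comp (primrec_dec.comp Primrec.snd))
  · refine primrec_testTable (R := fun (z : (ℕ × ℕ) × ℕ × ℕ) c' =>
      OutsideTest Y (dec z.1.2).2 z.2.1 c') ?_ (Primrec.snd.comp Primrec.snd)
    let γ := ((ℕ × ℕ) × ℕ × ℕ) × ℕ
    have hc : Primrec fun z : γ => (dec z.2).1 := Primrec.fst.comp (primrec_dec.comp Primrec.snd)
    refine primrecPred_exists_lt (R := fun (z : γ) V => ∃ V' < (dec z.2).1, _)
      (primrecPred_exists_lt (R := fun (z : γ × ℕ) V' => _)  ?_ (hc.comp Primrec.fst)) hc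
    have h0 : Primrec fun z : (γ × ℕ) × ℕ => z.1.1 := Primrec.fst.comp Primrec.fst
    have hc' : Primrec fun z : (γ × ℕ) × ℕ => (dec z.1.1.2).1 := hc.comp h0
    have hV : Primrec fun z : (γ × ℕ) × ℕ => z.1.2 := Primrec.snd.comp Primrec.fst
    have hV' : Primrec fun z : (γ × ℕ) × ℕ => z.2 := Primrec.snd
    have hP : Primrec fun z : (γ × ℕ) × ℕ => (dec z.1.1.1.1.2).2 :=
      Primrec.snd.comp (primrec_dec.comp (Primrec.snd.comp
        (Primrec.fst.comp (Primrec.fst.comp h0))))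
    have hN : Primrec fun z : (γ × ℕ) × ℕ => dec z.1.1.1.2.1 :=
      primrec_dec.comp (Primrec.fst.comp (Primrec.snd.comp (Primrec.fst.comp h0)))
    have hl : Primrec fun z : (γ × ℕ) × ℕ => (dec z.1.1.2).2 :=
      Primrec.snd.comp (primrec_dec.comp (Primrec.snd.comp h0))
    have hU := Primrec.unpair.comp hV
    have hU' := Primrec.unpair.comp hV'
    have h2 : Primrec fun n : ℕ => 2 ^ n := primrec_pow.comp (Primrec.const 2) Primrec.id
    refine PrimrecPred.and ?_ (PrimrecPred.and ?_ ?_)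
    · exact (primrec_far Y).comp (Primrec.pair (Primrec.fst.comp hU) (Primrec.pair
        (Primrec.fst.comp hU') (Primrec.pair (Primrec.nat_add.comp (h2.comp (Primrec.snd.comp hU))
        (h2.comp (Primrec.snd.comp hU')))
        (Primrec.nat_add.comp (Primrec.snd.comp hU) (Primrec.snd.comp hU'))))) hc'
    · exact primrecPred_memStage hP (primrec_ballList (Primrec.snd.comp hN) hV hc') hl
        (Primrec.fst.comp hN)
    · exact primrecPred_memStage hP (primrec_ballList (Primrec.snd.comp hN) hV' hc') hl
        (Primrec.fst.comp hN)
  · have hl : Primrec fun z : (ℕ × ℕ) × ℕ × ℕ => (dec z.2.2).2 :=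
      Primrec.snd.comp (primrec_dec.comp (Primrec.snd.comp Primrec.snd))
    have htest : PrimrecRel fun (z : (ℕ × ℕ) × ℕ × ℕ) k =>
        ValueTest Y (dec z.1.2).2 z.2.1 z.2.2 k := by
      have hN : Primrec fun z : ((ℕ × ℕ) × ℕ × ℕ) × ℕ => dec z.1.2.1 :=
        primrec_dec.comp (Primrec.fst.comp (Primrec.snd.comp Primrec.fst))
      refine primrecPred_memStage ?_ (primrec_ballList (Primrec.snd.comp hN) ?_
        (Primrec.list_length.comp (hl.comp Primrec.fst))) (hl.comp Primrec.fst)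
        (Primrec.fst.comp hN)
      · exact Primrec.snd.comp (primrec_dec.comp (Primrec.snd.comp (Primrec.fst.comp Primrec.fst)))
      · exact Primrec₂.natPair.comp Primrec.snd (Primrec.succ.comp (Primrec.fst.comp
          (primrec_dec.comp (Primrec.snd.comp (Primrec.snd.comp Primrec.fst)))))
    have hfind := Primrec.list_findIdx (Primrec.list_range.comp (Primrec.list_length.comp hl))
      htest.decide
    exact Primrec.ite (Primrec.nat_lt.comp hfind (Primrec.list_length.comp hl))
      (Primrec.succ.comp hfind) (Primrec.const 0)

variable {X : Type*} [RepSpace X] {p : ℕ → ℕ} {f : X → Y} {W : (ℕ → ℕ) → ℕ → Set X}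

theorem realizes_outsideTest (hp : IsSemidecided Y p W) (N : ℕ) {κ : ℕ → ℕ} (hκ : ∀ c, c ≤ κ c) :
    Realizes (testTable fun c => OutsideTest Y (pref p (κ c)) N c)
      (charFun (piece Y W N)ᶜ) := by
  refine realizes_testTable fun x q hq => ?_
  constructor
  · rintro ⟨t, V, -, V', -, hap, h1, h2⟩ hx
    simp only [dec_encode] at hap h1 h2
    exact hx V V' ((exists_apartStage_iff V V').1 ⟨_, hap⟩)
      ((hp _ _ x q hq).1 _ _ _ (isPref_pref _ _) (isPref_ballList _ _ _) (isPref_pref _ _) h1)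
      ((hp _ _ x q hq).1 _ _ _ (isPref_pref _ _) (isPref_ballList _ _ _) (isPref_pref _ _) h2)
  · intro hx
    simp only [piece, Set.mem_compl_iff, Set.mem_ofPred_eq] at hx
    push Not at hx
    obtain ⟨V, V', hap, h1, h2⟩ := hx
    obtain ⟨s, hs⟩ := (exists_apartStage_iff V V').2 hap
    obtain ⟨K₁, hK₁⟩ := (hp _ _ x q hq).2 h1
    obtain ⟨K₂, hK₂⟩ := (hp _ _ x q hq).2 h2
    obtain ⟨t, ht⟩ : ∃ t, t = V + V' + s + K₁ + K₂ + 1 := ⟨_, rfl⟩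
    have hκt := (le_encode_fst t (pref q (t + 1))).trans (hκ _)
    have hlen := le_length_ballList (dec N).2
    refine ⟨t, V, ?_, V', ?_, ?_⟩
    · rw [dec_encode]
      omega
    · rw [dec_encode]
      omega
    simp only [dec_encode]
    refine ⟨hs.mono (by omega), ?_, ?_⟩
    · refine hK₁ _ _ _ (isPref_pref _ _) (isPref_ballList _ _ _) (isPref_pref _ _) ?_ ?_ ?_
      · rw [length_pref]
        omega
      · exact le_trans (by omega) (hlen V t)
      · rw [length_pref]
        omega
    · refine hK₂ _ _ _ (isPref_pref _ _) (isPref_ballList _ _ _) (isPref_pref _ _) ?_ ?_ ?_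
      · rw [length_pref]
        omega
      · exact le_trans (by omega) (hlen V' t)
      · rw [length_pref]
        omega

theorem realizes_valueTable (hW : ∀ e, f ⁻¹' ballsUnion Y e = ⋂ i, W e i)
    (hp : IsSemidecided Y p W) (N : ℕ) {κ : ℕ → ℕ} (hκ : ∀ c, c ≤ κ c) :
    Realizes (fun c => valueTable Y (pref p (κ c)) N c) fun x : piece Y W N => f x := by
  classical
  rintro ⟨x, hx⟩ q hq
  have hq' : IsName q x := hq
  have hfind : ∀ t : ℕ, ∃ l, valueTable Y (pref p (κ (encode (t, pref q l)))) N
      (encode (t, pref q l)) ≠ 0 := by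
    intro t
    obtain ⟨k, hk⟩ := (denseRange (X := Y)).exists_dist_lt (f x)
      (by positivity : (0 : ℝ) < 1 / 2 ^ (t + 1))
    have hmem : x ∈ f ⁻¹' ballsUnion Y (ballSeq (dec N).2 (Nat.pair k (t + 1))) :=
      mem_ballsUnion_ballSeq (by simpa [ball] using hk) _
    rw [hW] at hmem
    obtain ⟨K, hK⟩ := (hp _ _ x q hq').2 (Set.mem_iInter.1 hmem (dec N).1)
    obtain ⟨l, hl⟩ : ∃ l, l = K + k + 1 := ⟨_, rfl⟩
    refine ⟨l, ?_⟩
    have hκt := (length_le_encode_snd t (pref q l)).trans (hκ _)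
    rw [length_pref] at hκt
    have htest : ValueTest Y (pref p (κ (encode (t, pref q l)))) N (encode (t, pref q l)) k := by
      simp only [ValueTest, dec_encode, length_pref]
      refine hK _ _ _ (isPref_pref _ _) (isPref_ballList _ _ _) (isPref_pref _ _) ?_ ?_ ?_
      · rw [length_pref]
        omega
      · exact le_trans (by omega) (le_length_ballList (dec N).2 _ l)
      · rw [length_pref]
        omega
    have h1 := (findIdx_range (fun k => decide (ValueTest Y (pref p (κ (encode (t, pref q l)))) N
      (encode (t, pref q l)) k)) l).2.1 k
    rw [valueTable, dec_encode, length_pref, if_pos]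
    · exact Nat.succ_ne_zero _
    · by_contra! hcon
      have := h1 (by omega)
      simp only [htest, decide_true] at this
      exact Bool.noConfusion this
  obtain ⟨r, hr, hr'⟩ := exists_applies (p := fun c => valueTable Y (pref p (κ c)) N c) hfind
  refine ⟨r, hr, fun t => ?_⟩
  obtain ⟨l, hl⟩ := hr' t
  rw [valueTable, dec_encode, length_pref] at hl
  split_ifs at hl with h
  have h1 := (findIdx_range (fun k => decide (ValueTest Y (pref p (κ (encode (t, pref q l)))) N
    (encode (t, pref q l)) k)) l).2.2 h
  rw [Nat.add_right_cancel hl] at h1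
  have h2 := of_decide_eq_true h1
  simp only [ValueTest, dec_encode] at h2
  have h3 := dist_le_of_mem_piece hW hx ((hp _ _ x q hq').1 _ _ _ (isPref_pref _ _)
    (isPref_ballList _ _ _) (isPref_pref _ _) h2)
  rw [Nat.unpair_pair] at h3
  refine h3.trans_lt (one_div_lt_one_div_of_lt (by positivity) ?_)
  exact pow_lt_pow_right₀ (by norm_num) (Nat.lt_succ_self t)

theorem exists_decomposition {g : ContFun (OpenSet Y) (Delta2Set X)} (hp : Realizes p g.toFun)
    (hg : IsPreimageMap g f) :
    ∃ p', Applies (decompositionTable Y) p p' ∧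
      ∃ s : ContFun ℕ (Σ A : ClosedSet X, ContFun A.carrier Y),
        Realizes p' s.toFun ∧ IsDecomposition s f := by
  obtain ⟨W, hW, hpW⟩ := exists_preimage_sets hp hg
  have hA := fun N => realizes_outsideTest hpW N (κ := id) fun _ => le_rfl
  have hB := fun N => realizes_valueTable hW hpW N (κ := id) fun _ => le_rfl
  let s : ℕ → Σ A : ClosedSet X, ContFun A.carrier Y := fun N =>
    ⟨⟨piece Y W N, _, hA N⟩, ⟨fun x => f x, _, hB N⟩⟩
  have hs : Realizes (fun n => pairTable
      (fun N => testTable fun c' => OutsideTest Y (pref p n) N c')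
      (fun N => valueTable Y (pref p n) N) n) s := by
    rintro N q rfl
    obtain ⟨r, hr, hr1, hr2⟩ := applies_pairTable
      (fun n N => testTable fun c' => OutsideTest Y (pref p n) N c')
      (fun n N => valueTable Y (pref p n) N) q
    refine ⟨r, hr, ?_, ?_⟩
    · rw [hr1, testTable_diagonal]
      exact realizes_outsideTest hpW (q 0) (κ := fun c => encode (2 * c, pref q 1))
        fun c => le_trans (by omega) (le_encode_fst _ _)
    · rw [hr2]
      exact realizes_valueTable hW hpW (q 0) (κ := fun c => encode (2 * c + 1, pref q 1))
        fun c => le_trans (by omega) (le_encode_fst _ _)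
  have happ : Applies (decompositionTable Y) p fun n => pairTable
      (fun N => testTable fun c' => OutsideTest Y (pref p n) N c')
      (fun N => valueTable Y (pref p n) N) n := by
    have h := applies_delay id (fun c => pairTable
      (fun N => testTable fun c' => OutsideTest Y (dec c).2 N c')
      (fun N => valueTable Y (dec c).2 N) (dec c).1) p
    simp only [dec_encode, id] at h
    exact h
  exact ⟨_, happ, ⟨s, _, hs⟩, hs,
    Set.eq_univ_of_forall fun x => Set.mem_iUnion.2 (exists_mem_piece hW hpW x), fun i x => rfl⟩

end Tables

/-! ### Exhausting an open set by closed sets -/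

section Shrink

variable (Y : Type*) [MetricSpace Y] [ComputableMetricSpace Y]

/-- The closed set of points that have a name beginning with `l` for which the distances are bounded
by `2 ^ (-k) * (1 - 2 ^ (-m))` instead of `2 ^ (-k)`. -/
def shrink (l : List ℕ) (m : ℕ) : Set Y :=
  {y | ∀ k < l.length, dist (denseSeq (l.getD k 0)) y ≤ ((2 ^ m - 1 : ℕ) : ℝ) / 2 ^ (k + m)}

theorem cast_two_pow_sub_one_div (k m : ℕ) :
    ((2 ^ m - 1 : ℕ) : ℝ) / 2 ^ (k + m) = 1 / 2 ^ k - 1 / 2 ^ (k + m) := by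
  rw [Nat.cast_sub Nat.one_le_two_pow]
  push_cast
  rw [pow_add]
  field_simp

variable {Y} {u : ℕ → ℕ} {U : Set Y}

theorem mem_of_mem_shrink (hu : Realizes u (charFun U)) {l : List ℕ} {t k m : ℕ}
    (h : 2 ≤ applyVal (pref u k) l t) {y : Y} (hy : y ∈ shrink Y l m) : y ∈ U := by
  obtain ⟨q, hq⟩ := exists_name y
  have hq' : IsName (fun a => l.getD a (q a)) y := by
    intro a
    rcases lt_or_ge a l.length with ha | ha
    · have h1 := hy a ha
      rw [cast_two_pow_sub_one_div, List.getD_eq_getElem _ _ ha] at h1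
      simp only [List.getD_eq_getElem _ _ ha]
      have h2 : (0 : ℝ) < 1 / 2 ^ (a + m) := by positivity
      linarith
    · simp only [List.getD_eq_default _ _ ha]
      exact hq a
  obtain ⟨r, hr, hrU⟩ := hu y _ hq'
  have hl : IsPref l fun a => l.getD a (q a) := isPref_of_getElem fun a ha => by
    rw [List.getD_eq_getElem _ _ ha]
  have h1 := applyVal_sound hr (isPref_pref u k) hl (n := t) (by omega)
  exact hrU.1 ⟨t, by omega⟩

theorem exists_mem_shrink (hu : Realizes u (charFun U)) {y : Y} (hy : y ∈ U) :
    ∃ l t k m, 2 ≤ applyVal (pref u k) l t ∧ y ∈ shrink Y l m := by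
  obtain ⟨q, hq⟩ := exists_name y
  obtain ⟨r, hr, hrU⟩ := hu y q hq
  obtain ⟨t, ht⟩ := hrU.2 hy
  obtain ⟨K, hK⟩ := applyVal_complete hr t
  have hm : ∀ k, ∃ m : ℕ, 1 / 2 ^ m < 1 / 2 ^ k - dist (denseSeq (q k)) y := fun k =>
    exists_one_div_two_pow_lt (sub_pos.2 (hq k))
  choose m hm using hm
  refine ⟨pref q K, t, K, (Finset.range K).sup m, ?_, fun k hk => ?_⟩
  · rw [hK _ _ (isPref_pref u K) (isPref_pref q K) (length_pref u K).ge (length_pref q K).ge]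
    have := Nat.pos_of_ne_zero ht
    omega
  · rw [(isPref_pref q K).getD hk, cast_two_pow_sub_one_div]
    rw [length_pref] at hk
    have h1 : m k ≤ k + (Finset.range K).sup m :=
      (Finset.le_sup (Finset.mem_range.2 hk)).trans (Nat.le_add_left _ _)
    have h2 : (1 : ℝ) / 2 ^ (k + (Finset.range K).sup m) ≤ 1 / 2 ^ m k :=
      one_div_le_one_div_of_le (by positivity) (pow_le_pow_right₀ (by norm_num) h1)
    have := hm k
    linarith

end Shrink

/-! ### Preimages under a piecewise continuous function -/

/-- The prefix of a name of the `i`-th member of a sequence that is determined by the prefix `P` of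
a name of the sequence. -/
def memberList (P : List ℕ) (i : ℕ) : List ℕ := applyList P (List.replicate P.length i)

/-- The index of a member of the sequences for a preimage: the number `i` of a piece, an input `l`,
an output index `t`, the length `k` of a prefix of a name of an open set, and a precision `m`. -/
abbrev preimageIndex (N : ℕ) : ℕ × List ℕ × ℕ × ℕ × ℕ :=
  Denumerable.ofNat (ℕ × List ℕ × ℕ × ℕ × ℕ) N

section Tests

variable (Y : Type*) [MetricSpace Y] [ComputableMetricSpace Y]

/-- The test, performed at the table position `c`, that a point is outside the `N`-th closed set in
the union for the preimage of an open set: it is outside the piece, or the open set is not known to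
contain the `shrink` set in question, or the value is outside this set. -/
def InnerTest (P L : List ℕ) (N c : ℕ) : Prop :=
  Accepts (applyList (evenList (memberList P (preimageIndex N).1)) (dec c).2) ∨
  ((preimageIndex N).2.2.2.1 ≤ L.length ∧
    applyVal (L.take (preimageIndex N).2.2.2.1) (preimageIndex N).2.1
      (preimageIndex N).2.2.1 < 2) ∨
  ∃ k < (preimageIndex N).2.1.length,
    ∃ b < (applyList (oddList (memberList P (preimageIndex N).1)) (dec c).2).length,
      Far Y ((preimageIndex N).2.1.getD k 0,
        (applyList (oddList (memberList P (preimageIndex N).1)) (dec c).2).getD b 0,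
        (2 ^ (preimageIndex N).2.2.2.2 - 1) * 2 ^ b + 2 ^ (k + (preimageIndex N).2.2.2.2),
        k + (preimageIndex N).2.2.2.2 + b) (dec c).1

/-- The test, performed at the table position `c`, that a point is in the `N`-th open set in the
intersection for the preimage of an open set: it is outside the piece, or the value is in the open
set. -/
def OuterTest (P L : List ℕ) (N c : ℕ) : Prop :=
  Accepts (applyList (evenList (memberList P (preimageIndex N).1)) (dec c).2) ∨
  Accepts (applyList L (applyList (oddList (memberList P (preimageIndex N).1)) (dec c).2))

/-- The table of a realizer of the preimage map, with access to the prefix `P` of a name of a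
decomposition. -/
noncomputable def preimageTable (P : List ℕ) : ℕ → ℕ :=
  delay id fun c => pairTable
    (fun N => testTable fun c' => InnerTest Y P (dec c).2 N c')
    (fun N => testTable fun c' => OuterTest P (dec c).2 N c') (dec c).1

/-- The table of a realizer that maps a name of a decomposition of a function to a name of its
preimage map. -/
noncomputable def preimageMapTable : ℕ → ℕ :=
  delay id fun c => preimageTable Y (dec c).2 (dec c).1

variable {Y}

section Primrec

variable {α : Type*} [Primcodable α]

theorem primrec_memberList {P : α → List ℕ} {i : α → ℕ} (hP : Primrec P) (hi : Primrec i) :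
    Primrec fun a => memberList (P a) (i a) :=
  primrec_applyList hP (primrec_replicate (Primrec.list_length.comp hP) hi)

theorem primrec_preimageIndex : Primrec preimageIndex := Primrec.ofNat _

theorem primrecPred_innerTest {P L : α → List ℕ} {N c : α → ℕ} (hP : Primrec P) (hL : Primrec L)
    (hN : Primrec N) (hc : Primrec c) :
    PrimrecPred fun a => InnerTest Y (P a) (L a) (N a) (c a) := by
  have hx := primrec_preimageIndex.comp hN
  have hi := Primrec.fst.comp hx
  have hl := Primrec.fst.comp (Primrec.snd.comp hx)
  have ht := Primrec.fst.comp (Primrec.snd.comp (Primrec.snd.comp hx))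
  have hk := Primrec.fst.comp (Primrec.snd.comp (Primrec.snd.comp (Primrec.snd.comp hx)))
  have hm := Primrec.snd.comp (Primrec.snd.comp (Primrec.snd.comp (Primrec.snd.comp hx)))
  have hq := Primrec.snd.comp (primrec_dec.comp hc)
  have hy := primrec_applyList (primrec_oddList.comp (primrec_memberList hP hi)) hq
  have h2 : Primrec fun n : ℕ => 2 ^ n := primrec_pow.comp (Primrec.const 2) Primrec.id
  refine PrimrecPred.or ?_ (PrimrecPred.or (PrimrecPred.and ?_ ?_) ?_)
  · exact primrecPred_accepts.comp
      (primrec_applyList (primrec_evenList.comp (primrec_memberList hP hi)) hq)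
  · exact Primrec.nat_le.comp hk (Primrec.list_length.comp hL)
  · exact Primrec.nat_lt.comp (primrec_applyVal.comp (Primrec.pair (Primrec.pair
      (Primrec.list_take.comp hk hL) hl) ht)) (Primrec.const 2)
  · refine primrecPred_exists_lt (R := fun a k => ∃ b < _, _) (primrecPred_exists_lt
      (R := fun (a : α × ℕ) b => _) ?_ (Primrec.list_length.comp (hy.comp Primrec.fst)))
      (Primrec.list_length.comp hl)
    have ha : Primrec fun z : (α × ℕ) × ℕ => z.1.1 := Primrec.fst.comp Primrec.fst
    have hk' : Primrec fun z : (α × ℕ) × ℕ => z.1.2 := Primrec.snd.comp Primrec.fst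
    have hb : Primrec fun z : (α × ℕ) × ℕ => z.2 := Primrec.snd
    have hkm := Primrec.nat_add.comp hk' (hm.comp ha)
    refine (primrec_far Y).comp (Primrec.pair ?_ (Primrec.pair ?_ (Primrec.pair ?_ ?_))) ?_
    · exact (Primrec.list_getD 0).comp (hl.comp ha) hk'
    · exact (Primrec.list_getD 0).comp (hy.comp ha) hb
    · exact Primrec.nat_add.comp (Primrec.nat_mul.comp (Primrec.nat_sub.comp
        (h2.comp (hm.comp ha)) (Primrec.const 1)) (h2.comp hb)) (h2.comp hkm)
    · exact Primrec.nat_add.comp hkm hb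
    · exact Primrec.fst.comp (primrec_dec.comp (hc.comp ha))

theorem primrecPred_outerTest {P L : α → List ℕ} {N c : α → ℕ} (hP : Primrec P) (hL : Primrec L)
    (hN : Primrec N) (hc : Primrec c) :
    PrimrecPred fun a => OuterTest (P a) (L a) (N a) (c a) := by
  have hR := primrec_memberList hP (Primrec.fst.comp (primrec_preimageIndex.comp hN))
  have hq := Primrec.snd.comp (primrec_dec.comp hc)
  exact (primrecPred_accepts.comp (primrec_applyList (primrec_evenList.comp hR) hq)).or
    (primrecPred_accepts.comp
      (primrec_applyList hL (primrec_applyList (primrec_oddList.comp hR) hq)))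

theorem primrec_preimageMapTable : Primrec (preimageMapTable Y) := by
  have hP : Primrec fun z : (((ℕ × ℕ) × ℕ) × ℕ × ℕ) × ℕ => (dec z.1.1.1.2).2 :=
    Primrec.snd.comp (primrec_dec.comp (Primrec.snd.comp
      (Primrec.fst.comp (Primrec.fst.comp Primrec.fst))))
  have hL : Primrec fun z : (((ℕ × ℕ) × ℕ) × ℕ × ℕ) × ℕ => (dec z.1.1.2).2 :=
    Primrec.snd.comp (primrec_dec.comp (Primrec.snd.comp (Primrec.fst.comp Primrec.fst)))
  have hN : Primrec fun z : (((ℕ × ℕ) × ℕ) × ℕ × ℕ) × ℕ => z.1.2.1 :=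
    Primrec.fst.comp (Primrec.snd.comp Primrec.fst)
  have h1 : Primrec fun z : (ℕ × ℕ) × ℕ => pairTable
      (fun N => testTable fun c' => InnerTest Y (dec z.1.2).2 (dec z.2).2 N c')
      (fun N => testTable fun c' => OuterTest (dec z.1.2).2 (dec z.2).2 N c') (dec z.2).1 :=
    primrec_pairTable
      (A := fun (z : (ℕ × ℕ) × ℕ) N => testTable fun c' =>
        InnerTest Y (dec z.1.2).2 (dec z.2).2 N c')
      (B := fun (z : (ℕ × ℕ) × ℕ) N => testTable fun c' =>
        OuterTest (dec z.1.2).2 (dec z.2).2 N c')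
      (primrec_testTable (R := fun (z : ((ℕ × ℕ) × ℕ) × ℕ × ℕ) c' =>
        InnerTest Y (dec z.1.1.2).2 (dec z.1.2).2 z.2.1 c')
        (primrecPred_innerTest hP hL hN Primrec.snd) (Primrec.snd.comp Primrec.snd))
      (primrec_testTable (R := fun (z : ((ℕ × ℕ) × ℕ) × ℕ × ℕ) c' =>
        OuterTest (dec z.1.1.2).2 (dec z.1.2).2 z.2.1 c')
        (primrecPred_outerTest hP hL hN Primrec.snd) (Primrec.snd.comp Primrec.snd))
      (Primrec.fst.comp (primrec_dec.comp Primrec.snd))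
  have h2 : Primrec fun z : ℕ × ℕ => preimageTable Y (dec z.2).2 (dec z.2).1 :=
    primrec_delay (α := ℕ × ℕ) (β := fun _ => id) (T := fun z c => pairTable
      (fun N => testTable fun c' => InnerTest Y (dec z.2).2 (dec c).2 N c')
      (fun N => testTable fun c' => OuterTest (dec z.2).2 (dec c).2 N c') (dec c).1)
      Primrec.snd.to₂ h1.to₂ (Primrec.fst.comp (primrec_dec.comp Primrec.snd))
  exact primrec_delay (α := ℕ) (β := fun _ => id) Primrec.snd.to₂ h2.to₂ Primrec.id

end Primrec

end Tests

section Sets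

variable {X Y : Type*} {A : ℕ → Set X} {f : X → Y} {U : Set Y}

/-- The `N`-th open set in the intersection for the preimage of `U`. -/
def outerSet (U : Set Y) (A : ℕ → Set X) (f : X → Y) (N : ℕ) : Set X :=
  {x | x ∈ A (preimageIndex N).1 → f x ∈ U}

theorem preimage_eq_iInter_outerSet (hA : ∀ x, ∃ i, x ∈ A i) :
    f ⁻¹' U = ⋂ N, outerSet U A f N := by
  ext x
  rw [Set.mem_iInter]
  constructor
  · exact fun hx N _ => hx
  · intro hx
    obtain ⟨i, hi⟩ := hA x
    have h1 := hx (encode (i, ([] : List ℕ), 0, 0, 0))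
    simp only [outerSet, preimageIndex, Denumerable.ofNat_encode] at h1
    exact h1 hi

variable [MetricSpace Y] [ComputableMetricSpace Y] {u : ℕ → ℕ}

/-- The `N`-th closed set in the union for the preimage of an open set with name `u`. -/
def innerSet (u : ℕ → ℕ) (A : ℕ → Set X) (f : X → Y) (N : ℕ) : Set X :=
  {x | x ∈ A (preimageIndex N).1 ∧
    2 ≤ applyVal (pref u (preimageIndex N).2.2.2.1) (preimageIndex N).2.1
      (preimageIndex N).2.2.1 ∧
    f x ∈ shrink Y (preimageIndex N).2.1 (preimageIndex N).2.2.2.2}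

theorem preimage_eq_iUnion_innerSet (hA : ∀ x, ∃ i, x ∈ A i) (hu : Realizes u (charFun U)) :
    f ⁻¹' U = ⋃ N, innerSet u A f N := by
  ext x
  rw [Set.mem_iUnion]
  constructor
  · intro hx
    obtain ⟨i, hi⟩ := hA x
    obtain ⟨l, t, k, m, h1, h2⟩ := exists_mem_shrink hu hx
    refine ⟨encode (i, l, t, k, m), ?_⟩
    simp only [innerSet, preimageIndex, Denumerable.ofNat_encode]
    exact ⟨hi, h1, h2⟩
  · rintro ⟨N, -, h1, h2⟩
    exact mem_of_mem_shrink hu h1 h2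

end Sets

section Realizers

variable {X Y : Type*} [RepSpace X] [MetricSpace Y] [ComputableMetricSpace Y]

/-- The sequence `p` is a name of a sequence of closed sets `A i` and of the restrictions of `f` to
these sets; names of the members of this sequence are the sequences `r i`. -/
structure NamesPieces (p : ℕ → ℕ) (r : ℕ → ℕ → ℕ) (A : ℕ → Set X) (f : X → Y) : Prop where
  applies : ∀ i, Applies p (fun _ => i) (r i)
  closed : ∀ i, Realizes (evenPart (r i)) (charFun (A i)ᶜ)
  restrict : ∀ i, Realizes (oddPart (r i)) fun x : A i => f x

theorem exists_namesPieces {p : ℕ → ℕ} {s : ContFun ℕ (Σ A : ClosedSet X, ContFun A.carrier Y)}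
    {f : X → Y} (hp : Realizes p s.toFun) (hs : IsDecomposition s f) :
    ∃ r A, NamesPieces p r A f ∧ ∀ x, ∃ i, x ∈ A i := by
  have h : ∀ i, ∃ r, Applies p (fun _ => i) r ∧ IsName r (s.toFun i) := fun i => hp i _ rfl
  choose r hr hr' using h
  refine ⟨r, fun i => (s.toFun i).1.carrier, ⟨hr, fun i => (hr' i).1, fun i => ?_⟩, fun x => ?_⟩
  · rw [← funext (hs.2 i)]
    exact (hr' i).2
  · have hx : x ∈ ⋃ i, (s.toFun i).1.carrier := by
      rw [hs.1]
      exact Set.mem_univ x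
    exact Set.mem_iUnion.1 hx

namespace NamesPieces

variable {p : ℕ → ℕ} {r : ℕ → ℕ → ℕ} {A : ℕ → Set X} {f : X → Y}

theorem isPref_memberList (h : NamesPieces p r A f) (i : ℕ) {P : List ℕ} (hP : IsPref P p) :
    IsPref (memberList P i) (r i) :=
  applyList_sound (h.applies i) hP (isPref_replicate _ _)

theorem exists_le_length (h : NamesPieces p r A f) (i n : ℕ) :
    ∃ K, ∀ P, IsPref P p → K ≤ P.length →
      n ≤ (evenList (memberList P i)).length ∧ n ≤ (oddList (memberList P i)).length := by
  obtain ⟨K, hK⟩ := applyList_complete (h.applies i) (2 * n)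
  refine ⟨K, fun P hP hKP => ?_⟩
  have h1 : 2 * n ≤ (memberList P i).length :=
    hK P _ hP (isPref_replicate _ _) hKP (by rwa [List.length_replicate])
  rw [length_evenList, length_oddList]
  omega

theorem notMem_of_accepts (h : NamesPieces p r A f) {i : ℕ} {x : X} {q : ℕ → ℕ} (hq : IsName q x)
    {P Q : List ℕ} (hP : IsPref P p) (hQ : IsPref Q q)
    (hacc : Accepts (applyList (evenList (memberList P i)) Q)) : x ∉ A i :=
  mem_of_accepts (h.closed i) hq (h.isPref_memberList i hP).evenList hQ hacc

theorem exists_accepts_of_notMem (h : NamesPieces p r A f) {i : ℕ} {x : X} {q : ℕ → ℕ}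
    (hq : IsName q x) (hx : x ∉ A i) : ∃ K, ∀ P Q, IsPref P p → IsPref Q q → K ≤ P.length →
      K ≤ Q.length → Accepts (applyList (evenList (memberList P i)) Q) := by
  obtain ⟨K₁, hK₁⟩ := exists_accepts (h.closed i) hq hx
  obtain ⟨K₂, hK₂⟩ := h.exists_le_length i K₁
  exact ⟨max K₁ K₂, fun P Q hP hQ hKP hKQ => hK₁ _ _ (h.isPref_memberList i hP).evenList hQ
    (hK₂ P hP ((le_max_right _ _).trans hKP)).1 ((le_max_left _ _).trans hKQ)⟩

/-- On a piece, prefixes of a name of the value of `f` are computed from prefixes of a name of the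
decomposition and of a name of the argument. -/
theorem exists_name_value (h : NamesPieces p r A f) {i : ℕ} {x : X} {q : ℕ → ℕ}
    (hq : IsName q x) (hx : x ∈ A i) : ∃ y, IsName y (f x) ∧
      (∀ P Q, IsPref P p → IsPref Q q → IsPref (applyList (oddList (memberList P i)) Q) y) ∧
      ∀ n, ∃ K, ∀ P Q, IsPref P p → IsPref Q q → K ≤ P.length → K ≤ Q.length →
        n ≤ (applyList (oddList (memberList P i)) Q).length := by
  obtain ⟨y, hy, hyf⟩ := h.restrict i ⟨x, hx⟩ q hq
  refine ⟨y, hyf, fun P Q hP hQ => applyList_sound hy (h.isPref_memberList i hP).oddList hQ,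
    fun n => ?_⟩
  obtain ⟨K₁, hK₁⟩ := applyList_complete hy n
  obtain ⟨K₂, hK₂⟩ := h.exists_le_length i K₁
  exact ⟨max K₁ K₂, fun P Q hP hQ hKP hKQ => hK₁ _ _ (h.isPref_memberList i hP).oddList hQ
    (hK₂ P hP ((le_max_right _ _).trans hKP)).2 ((le_max_left _ _).trans hKQ)⟩

end NamesPieces

variable {p u : ℕ → ℕ} {r : ℕ → ℕ → ℕ} {A : ℕ → Set X} {f : X → Y} {U : Set Y}
variable {κ μ : ℕ → ℕ}

theorem realizes_outerTest (h : NamesPieces p r A f) (hu : Realizes u (charFun U)) (N : ℕ)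
    (hκ : ∀ c, c ≤ κ c) (hμ : ∀ c, c ≤ μ c) :
    Realizes (testTable fun c => OuterTest (pref p (κ c)) (pref u (μ c)) N c)
      (charFun (outerSet U A f N)) := by
  refine realizes_testTable fun x q hq => ?_
  constructor
  · rintro ⟨t, ht⟩ hx
    simp only [OuterTest, dec_encode] at ht
    rcases ht with ht | ht
    · exact absurd hx (h.notMem_of_accepts hq (isPref_pref _ _) (isPref_pref _ _) ht)
    · obtain ⟨y, hy, hyp, -⟩ := h.exists_name_value hq hx
      exact mem_of_accepts hu hy (isPref_pref _ _) (hyp _ _ (isPref_pref _ _) (isPref_pref _ _)) ht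
  · intro hx
    have hlen : ∀ t, t ≤ κ (encode (t, pref q (t + 1))) ∧ t ≤ μ (encode (t, pref q (t + 1))) :=
      fun t => ⟨(le_encode_fst _ _).trans (hκ _), (le_encode_fst _ _).trans (hμ _)⟩
    by_cases hxA : x ∈ A (preimageIndex N).1
    · obtain ⟨y, hy, hyp, hyl⟩ := h.exists_name_value hq hxA
      obtain ⟨K₁, hK₁⟩ := exists_accepts hu hy (hx hxA)
      obtain ⟨K₂, hK₂⟩ := hyl K₁
      refine ⟨max K₁ K₂, Or.inr ?_⟩
      simp only [dec_encode]
      have h1 := hlen (max K₁ K₂)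
      refine hK₁ _ _ (isPref_pref _ _) (hyp _ _ (isPref_pref _ _) (isPref_pref _ _)) ?_
        (hK₂ _ _ (isPref_pref _ _) (isPref_pref _ _) ?_ ?_) <;>
      · rw [length_pref]
        omega
    · obtain ⟨K, hK⟩ := h.exists_accepts_of_notMem hq hxA
      refine ⟨K, Or.inl ?_⟩
      simp only [dec_encode]
      have h1 := hlen K
      refine hK _ _ (isPref_pref _ _) (isPref_pref _ _) ?_ ?_ <;>
      · rw [length_pref]
        omega

theorem realizes_innerTest (h : NamesPieces p r A f) (N : ℕ) (hκ : ∀ c, c ≤ κ c)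
    (hμ : ∀ c, c ≤ μ c) :
    Realizes (testTable fun c => InnerTest Y (pref p (κ c)) (pref u (μ c)) N c)
      (charFun (innerSet u A f N)ᶜ) := by
  have key : ∀ m k b : ℕ, (((2 ^ m - 1) * 2 ^ b + 2 ^ (k + m) : ℕ) : ℝ) / 2 ^ (k + m + b) =
      ((2 ^ m - 1 : ℕ) : ℝ) / 2 ^ (k + m) + 1 / 2 ^ b := by
    intro m k b
    rw [pow_add _ (k + m) b]
    push_cast
    field_simp
  refine realizes_testTable fun x q hq => ?_
  constructor
  · rintro ⟨t, ht⟩ ⟨hx, hacc, hshrink⟩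
    simp only [InnerTest, dec_encode] at ht
    rcases ht with ht | ⟨hk, ht⟩ | ⟨k, hk, b, hb, ht⟩
    · exact absurd hx (h.notMem_of_accepts hq (isPref_pref _ _) (isPref_pref _ _) ht)
    · rw [(isPref_pref _ _).take hk] at ht
      omega
    · obtain ⟨y, hy, hyp, -⟩ := h.exists_name_value hq hx
      have h1 := (exists_far_iff Y _ _ _ _).1 ⟨_, ht⟩
      rw [key, (hyp _ _ (isPref_pref _ _) (isPref_pref _ _)).getD hb] at h1
      have h2 := hshrink k hk
      have h3 := hy b
      have h4 := dist_triangle_right (denseSeq ((preimageIndex N).2.1.getD k 0))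
        (denseSeq (y b)) (f x)
      linarith
  · intro hx
    have hlen : ∀ t, t ≤ κ (encode (t, pref q (t + 1))) ∧ t ≤ μ (encode (t, pref q (t + 1))) :=
      fun t => ⟨(le_encode_fst _ _).trans (hκ _), (le_encode_fst _ _).trans (hμ _)⟩
    by_cases hxA : x ∈ A (preimageIndex N).1
    · by_cases hacc : 2 ≤ applyVal (pref u (preimageIndex N).2.2.2.1) (preimageIndex N).2.1
          (preimageIndex N).2.2.1
      · have hshrink : f x ∉ shrink Y (preimageIndex N).2.1 (preimageIndex N).2.2.2.2 :=
          fun hf => hx ⟨hxA, hacc, hf⟩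
        simp only [shrink, Set.mem_ofPred_eq] at hshrink
        push Not at hshrink
        obtain ⟨k, hk, hlt⟩ := hshrink
        obtain ⟨b, hb⟩ := exists_one_div_two_pow_lt (half_pos (sub_pos.2 hlt))
        obtain ⟨y, hy, hyp, hyl⟩ := h.exists_name_value hq hxA
        have hfar : (((2 ^ (preimageIndex N).2.2.2.2 - 1) * 2 ^ b +
            2 ^ (k + (preimageIndex N).2.2.2.2) : ℕ) : ℝ) /
            2 ^ (k + (preimageIndex N).2.2.2.2 + b) <
            dist (denseSeq ((preimageIndex N).2.1.getD k 0) : Y) (denseSeq (y b)) := by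
          rw [key]
          have h3 := hy b
          have h4 := dist_triangle (denseSeq ((preimageIndex N).2.1.getD k 0))
            (denseSeq (y b)) (f x)
          linarith
        obtain ⟨s, hs⟩ := (exists_far_iff Y _ _ _ _).2 hfar
        obtain ⟨K, hK⟩ := hyl (b + 1)
        refine ⟨max s K, Or.inr (Or.inr ⟨k, hk, b, ?_⟩)⟩
        simp only [dec_encode]
        have h1 := hlen (max s K)
        have hb' : b < (applyList (oddList (memberList
            (pref p (κ (encode (max s K, pref q (max s K + 1))))) (preimageIndex N).1))
            (pref q (max s K + 1))).length := by
          refine hK _ _ (isPref_pref _ _) (isPref_pref _ _) ?_ ?_ <;>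
          · rw [length_pref]
            omega
        refine ⟨hb', ?_⟩
        rw [(hyp _ _ (isPref_pref _ _) (isPref_pref _ _)).getD hb']
        exact hs.mono (le_max_left _ _)
      · refine ⟨(preimageIndex N).2.2.2.1, Or.inr (Or.inl ?_)⟩
        have h1 := (hlen (preimageIndex N).2.2.2.1).2
        rw [length_pref, (isPref_pref _ _).take (by rwa [length_pref])]
        exact ⟨h1, not_le.1 hacc⟩
    · obtain ⟨K, hK⟩ := h.exists_accepts_of_notMem hq hxA
      refine ⟨K, Or.inl ?_⟩
      simp only [dec_encode]
      have h1 := hlen K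
      refine hK _ _ (isPref_pref _ _) (isPref_pref _ _) ?_ ?_ <;>
      · rw [length_pref]
        omega

/-- A name of a decomposition yields a table that maps each name of an open set to a name of a
sequence presenting its preimage. -/
theorem exists_applies_preimageTable (h : NamesPieces p r A f) (hA : ∀ x, ∃ i, x ∈ A i)
    (hu : Realizes u (charFun U)) :
    ∃ σ, Applies (fun c => preimageTable Y (pref p c) c) u σ ∧
      ∃ s : ContFun ℕ (ClosedSet X × OpenSet X),
        Realizes σ s.toFun ∧ Delta2Presents s (f ⁻¹' U) := by
  have hin := fun N => realizes_innerTest (u := u) h N (κ := id) (μ := id) (fun _ => le_rfl)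
    fun _ => le_rfl
  have hout := fun N => realizes_outerTest h hu N (κ := id) (μ := id) (fun _ => le_rfl)
    fun _ => le_rfl
  let s : ℕ → ClosedSet X × OpenSet X := fun N =>
    (⟨innerSet u A f N, _, hin N⟩, ⟨outerSet U A f N, _, hout N⟩)
  have hs : Realizes (fun m => pairTable
      (fun N => testTable fun c' => InnerTest Y (pref p (encode (m, pref u m))) (pref u m) N c')
      (fun N => testTable fun c' => OuterTest (pref p (encode (m, pref u m))) (pref u m) N c')
      m) s := by
    rintro N q rfl
    obtain ⟨r', hr, hr1, hr2⟩ := applies_pairTable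
      (fun m N => testTable fun c' => InnerTest Y (pref p (encode (m, pref u m))) (pref u m) N c')
      (fun m N => testTable fun c' => OuterTest (pref p (encode (m, pref u m))) (pref u m) N c') q
    have h1 : ∀ c, c ≤ encode (2 * c, pref q 1) := fun c =>
      le_trans (by omega) (le_encode_fst _ _)
    have h2 : ∀ c, c ≤ encode (2 * c + 1, pref q 1) := fun c =>
      le_trans (by omega) (le_encode_fst _ _)
    refine ⟨r', hr, ?_, ?_⟩
    · rw [hr1, testTable_diagonal]
      exact realizes_innerTest h (q 0)
        (κ := fun c => encode (encode (2 * c, pref q 1), pref u (encode (2 * c, pref q 1))))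
        (μ := fun c => encode (2 * c, pref q 1)) (fun c => (h1 c).trans (le_encode_fst _ _)) h1
    · rw [hr2, testTable_diagonal]
      exact realizes_outerTest h hu (q 0)
        (κ := fun c => encode (encode (2 * c + 1, pref q 1), pref u (encode (2 * c + 1, pref q 1))))
        (μ := fun c => encode (2 * c + 1, pref q 1)) (fun c => (h2 c).trans (le_encode_fst _ _)) h2
  have happ : Applies (fun c => preimageTable Y (pref p c) c) u fun m => pairTable
      (fun N => testTable fun c' => InnerTest Y (pref p (encode (m, pref u m))) (pref u m) N c')
      (fun N => testTable fun c' => OuterTest (pref p (encode (m, pref u m))) (pref u m) N c')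
      m := by
    have h := applies_delay id (fun c => pairTable
      (fun N => testTable fun c' => InnerTest Y (pref p c) (dec c).2 N c')
      (fun N => testTable fun c' => OuterTest (pref p c) (dec c).2 N c') (dec c).1) u
    simp only [dec_encode, id] at h
    exact h
  exact ⟨_, happ, ⟨s, _, hs⟩, hs, preimage_eq_iUnion_innerSet hA hu,
    preimage_eq_iInter_outerSet hA⟩

theorem exists_preimageMap {s : ContFun ℕ (Σ A : ClosedSet X, ContFun A.carrier Y)}
    (hp : Realizes p s.toFun) (hs : IsDecomposition s f) :
    ∃ p', Applies (preimageMapTable Y) p p' ∧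
      ∃ g : ContFun (OpenSet Y) (Delta2Set X), Realizes p' g.toFun ∧ IsPreimageMap g f := by
  obtain ⟨r, A, h, hA⟩ := exists_namesPieces hp hs
  have hpre : ∀ U : OpenSet Y, ∃ s : ContFun ℕ (ClosedSet X × OpenSet X),
      Delta2Presents s (f ⁻¹' U.carrier) := by
    intro U
    obtain ⟨u, hu⟩ := U.realizable
    obtain ⟨-, -, s, -, hs⟩ := exists_applies_preimageTable h hA hu
    exact ⟨s, hs⟩
  have hg : Realizes (fun c => preimageTable Y (pref p c) c)
      fun U : OpenSet Y => (⟨f ⁻¹' U.carrier, hpre U⟩ : Delta2Set X) := by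
    intro U u hu
    obtain ⟨σ, hσ, s, hs, hsU⟩ := exists_applies_preimageTable h hA hu
    exact ⟨σ, hσ, s, hs, hsU⟩
  have happ : Applies (preimageMapTable Y) p fun c => preimageTable Y (pref p c) c := by
    have h := applies_delay id (fun c => preimageTable Y (dec c).2 (dec c).1) p
    simp only [dec_encode, id] at h
    exact h
  exact ⟨_, happ, ⟨_, _, hg⟩, hg, fun U => rfl⟩

end Realizers

end TTE

theorem theorem10 (X Y : Type*) [MetricSpace X] [TTE.ComputableMetricSpace X]
    [MetricSpace Y] [TTE.ComputableMetricSpace Y] :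
    (∃ h : ∀ f : TTE.Delta2Fun X Y, TTE.IsPiecewiseContinuous f.toFun,
      TTE.IsComputable
        (fun f : TTE.Delta2Fun X Y => (⟨f.toFun, h f⟩ : TTE.PiecewiseFun X Y))) ∧
    (∃ h : ∀ f : TTE.PiecewiseFun X Y, TTE.IsDelta2Measurable f.toFun,
      TTE.IsComputable
        (fun f : TTE.PiecewiseFun X Y => (⟨f.toFun, h f⟩ : TTE.Delta2Fun X Y))) := by
  refine ⟨⟨fun f => ?_, TTE.decompositionTable Y, TTE.primrec_decompositionTable.to_comp, ?_⟩,
    ⟨fun f => ?_, TTE.preimageMapTable Y, TTE.primrec_preimageMapTable.to_comp, ?_⟩⟩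
  · obtain ⟨g, hg⟩ := f.measurable
    obtain ⟨p, hp⟩ := g.realizable
    obtain ⟨-, -, s, -, hs⟩ := TTE.exists_decomposition hp hg
    exact ⟨s, hs⟩
  · rintro f p ⟨g, hp, hg⟩
    obtain ⟨p', hp', s, hs, hsf⟩ := TTE.exists_decomposition hp hg
    exact ⟨p', hp', s, hs, hsf⟩
  · obtain ⟨s, hs⟩ := f.piecewise
    obtain ⟨p, hp⟩ := s.realizable
    obtain ⟨-, -, g, -, hg⟩ := TTE.exists_preimageMap hp hs
    exact ⟨g, hg⟩
  · rintro f p ⟨s, hp, hs⟩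
    obtain ⟨p', hp', g, hg, hgf⟩ := TTE.exists_preimageMap hp hs
    exact ⟨p', hp', g, hg, hgf⟩
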